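/- **Theorem (unique ergodicity of the fully discrete scheme).** *Setting.* Let $(\Omega,\mathcal F,\{\mathcal F_t\}_{t\ge 0},\mathbb P)$ be a filtered probability space and let $\beta_k=\beta_k^1+\mathbf i\beta_k^2$, $k\ge 1$, where $\{\beta_k^i\}_{k\ge1,\,i=1,2}$ are independent real $\{\mathcal F_t\}$-Brownian motions (they are adapted, and the increments of the whole family after time $s$ are independent of $\mathcal F_s$). Let $\alpha>0$, $\epsilon\ge 0$, $\lambda\in\{1,-1\}$, let $e_k(x)=\sqrt2\sin(k\pi x)$, and let $Q$ be a bounded positive linear operator on $L^2=L^2(0,1;\mathbb C)$ with $Qe_k=\sqrt{\eta_k}\,e_k$, $\eta_k\ge 0$, for $k\ge1$. Let $\psi_0$ be a jointly measurable random function on $[0,1]$ with values in $\mathbb C$ such that $\psi_0(x)$ is $\mathcal F_0$-measurable for every $x$. Let $J\ge 1$ and $P\ge J$ be integers, $h=1/(J+1)$, $x_j=jh$, and $\tau>0$. Put $t_n=n\tau$, $\delta_{n+1}\beta=(\beta_k(t_{n+1})-\beta_k(t_n))_{k=1}^P\in\mathbb C^P$, let $A\in\mathbb R^{J\times J}$ be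 the tridiagonal matrix with $-2$ on the diagonal and $1$ on the two neighbouring diagonals, $\sigma=(e_k(x_j))_{1\le j\le J,\,1\le k\le P}$, $\Lambda=\mathrm{diag}(\sqrt{\eta_1},\dots,\sqrt{\eta_P})$, $F(u)=\mathrm{diag}(|u_1|^2,\dots,|u_J|^2)$ and $f(u)=\left(-\tfrac12\alpha I+\mathbf i\lambda F(u)\right)\tau$ for $u\in\mathbb C^J$. Let $\{\Psi^n\}_{n\ge 0}$, with $\Psi^n$ being $\mathcal F_{t_n}$-measurable, be the solution in $\mathbb C^J$ of the scheme $\Psi^0=(\psi_0(x_1),\dots,\psi_0(x_J))^T$, $$\Psi^{n+1}-e^{f(\Psi^n)}\Psi^n=\mathbf i\frac{\tau}{2h^2}A\left(\Psi^{n+1}+e^{f(\Psi^n)}\Psi^n\right)-\frac14\alpha\tau\left(\Psi^{n+1}+e^{f(\Psi^n)}\Psi^n\right)+\epsilon\sigma\Lambda\,\delta_{n+1}\beta,\qquad n\ge 0 .$$ *Hypotheses.* Assume that $\mathbb E\|\psi_0\|_{L^2}^2<\infty$; that $Q$ is Hilbert–Schmidt from $L^2$ to $\dot H^2$, that is $\sum_{k\ge1}\|Qe_k\|_{\dot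 H^2}^2<\infty$, where $\|u\|_{\dot H^2}^2=\sum_{k\ge1}(k\pi)^4|(u,e_k)|^2$; that $P\le C_*(J+1)$ for some constant $C_*\ge 1$; and that $\eta_k>0$ for $k=1,\dots,P$. *Conclusion.* $\{\Psi^n\}_{n\ge0}$ is a homogeneous Markov chain with respect to $\{\mathcal F_{t_n}\}$, whose transition kernel is $$\Pi(u,S)=\mathbb P(U\in S),$$ where $U\in\mathbb C^J$ is the solution of one step of the scheme started at $u\in\mathbb C^J$ with increment $z\in\mathbb C^P$, the $2P$ real and imaginary parts of the components of $z$ being independent and $N(0,\tau)$-distributed. There is exactly one probability measure $\mu_h^\tau$ on $\mathbb C^J$ that is invariant for $\Pi$, and $$\lim_{N\to\infty}\frac1N\sum_{n=0}^{N-1}\mathbb E\,g(\Psi^n)=\int_{\mathbb C^J}g\,d\mu_h^\tau\qquad\text{for every bounded continuous } g:\mathbb C^J\to\mathbb R .$$ -/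

import Mathlib

open MeasureTheory ProbabilityTheory Filter Topology
open scoped NNReal ENNReal Matrix

namespace DampedNLS

noncomputable section

/-! ### The Dirichlet eigenbasis of the Laplacian on `(0,1)` and the spaces `Ḣ^p` -/

/-- The eigenfunction `e_k(x) = √2 sin (k π x)`, `k = 1, 2, …`. -/
def eigenfun (k : ℕ+) (x : ℝ) : ℝ := √2 * Real.sin (k * Real.pi * x)

/-- The complex Hilbert space `L²(0,1)`. -/
abbrev L2 : Type := Lp ℂ 2 (volume.restrict (Set.Ioo (0 : ℝ) 1))

theorem memLp_eigenfun (k : ℕ+) :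
    MemLp (fun x : ℝ => (eigenfun k x : ℂ)) 2 (volume.restrict (Set.Ioo (0 : ℝ) 1)) := by
  refine MemLp.of_bound (C := √2) ?_ ?_
  · refine Continuous.aestronglyMeasurable ?_
    unfold eigenfun
    fun_prop
  · refine ae_of_all _ fun x => ?_
    rw [Complex.norm_real, eigenfun, norm_mul, Real.norm_of_nonneg (Real.sqrt_nonneg 2)]
    exact mul_le_of_le_one_right (Real.sqrt_nonneg 2) (Real.abs_sin_le_one _)

/-- The eigenfunction `e_k` as an element of `L²(0,1)`. -/
def eigenvec (k : ℕ+) : L2 := (memLp_eigenfun k).toLp _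

/-- `‖u‖²` in `Ḣ^p = D(Δ^{p/2})`, that is `∑ₖ (kπ)^{2p} |(u, e_k)|²`; it is `∞` when `u ∉ Ḣ^p`. -/
def hdotNormSq (p : ℕ) (u : L2) : ℝ≥0∞ :=
  ∑' k : ℕ+, ENNReal.ofReal ((k * Real.pi) ^ (2 * p) * ‖inner ℂ (eigenvec k) u‖ ^ 2)

/-- `Q` is a Hilbert–Schmidt operator from `L²` to `Ḣ^p`: `∑ₖ ‖Q e_k‖²_{Ḣ^p} < ∞`. -/
def IsHilbertSchmidtHdot (p : ℕ) (Q : L2 →L[ℂ] L2) : Prop :=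
  ∑' k : ℕ+, hdotNormSq p (Q (eigenvec k)) < ∞

/-! ### The driving noise -/

/-- `β = (β_k)_{k ≥ 1}` with `β_k = β_k¹ + i β_k²`, where the `β_k¹, β_k²` are independent real
Brownian motions relative to the filtration `ℱ`: they are adapted and, after each time `s`,
the increments of the family are independent of `ℱ s`. -/
structure IsComplexWiener {Ω : Type*} {mΩ : MeasurableSpace Ω} (ℱ : Filtration ℝ≥0 mΩ)
    (β : ℕ+ → ℝ≥0 → Ω → ℂ) (Pr : Measure Ω) : Prop where
  brownian_re : ∀ k, IsBrownianReal (fun t ω => (β k t ω).re) Pr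
  brownian_im : ∀ k, IsBrownianReal (fun t ω => (β k t ω).im) Pr
  indep : iIndepFun (fun (i : ℕ+ × Bool) (ω : Ω) (t : ℝ≥0) =>
    if i.2 then (β i.1 t ω).im else (β i.1 t ω).re) Pr
  adapted : ∀ k, Adapted ℱ (β k)
  indep_increments : ∀ s t : ℝ≥0, s ≤ t →
    Indep (MeasurableSpace.comap (fun (ω : Ω) (k : ℕ+) => β k t ω - β k s ω) inferInstance)
      (ℱ s) Pr

/-! ### The fully discrete scheme -/

/-- The grid has the interior points `x_j = j h`, `j = 1, …, J`, where `(J + 1) h = 1`. -/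
def meshSize (J : ℕ) : ℝ := 1 / (J + 1)

/-- The grid point `x_{j+1} = (j + 1) h` for the `0`-based index `j : Fin J`. -/
def gridPoint (J : ℕ) (j : Fin J) : ℝ := (j + 1) * meshSize J

/-- The tridiagonal matrix `A` with `-2` on the diagonal and `1` next to it. -/
def laplaceMatrix (J : ℕ) : Matrix (Fin J) (Fin J) ℂ :=
  Matrix.of fun i j =>
    if i = j then -2 else if (i : ℕ) + 1 = j ∨ (j : ℕ) + 1 = i then 1 else 0

/-- The `J × P` matrix `σ = (e_k(x_j))`; the index `k : Fin P` stands for the mode `k + 1`. -/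
def sigmaMatrix (J P : ℕ) : Matrix (Fin J) (Fin P) ℂ :=
  Matrix.of fun j k => (eigenfun (k : ℕ).succPNat (gridPoint J j) : ℂ)

/-- `Λ = diag (√η_1, …, √η_P)`. -/
def lambdaMatrix (P : ℕ) (η : ℕ+ → ℝ) : Matrix (Fin P) (Fin P) ℂ :=
  Matrix.diagonal fun k => ((√(η (k : ℕ).succPNat) : ℝ) : ℂ)

/-- `F(u) = diag (|u_1|², …, |u_J|²)`. -/
def intensity {J : ℕ} (u : Fin J → ℂ) : Matrix (Fin J) (Fin J) ℂ :=
  Matrix.diagonal fun j => ((‖u j‖ ^ 2 : ℝ) : ℂ)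

/-- `f(u) = (-(α/2) I + i λ F(u)) τ`. -/
def expArg {J : ℕ} (α lam : ℝ) (τ : ℝ≥0) (u : Fin J → ℂ) : Matrix (Fin J) (Fin J) ℂ :=
  ((τ : ℝ) : ℂ) • (-((α : ℂ) / 2) • (1 : Matrix (Fin J) (Fin J) ℂ)
    + (Complex.I * (lam : ℂ)) • intensity u)

/-- `e^{f(u)} u`. -/
def substep {J : ℕ} (α lam : ℝ) (τ : ℝ≥0) (u : Fin J → ℂ) : Fin J → ℂ :=
  NormedSpace.exp (expArg α lam τ u) *ᵥ u

/-- One step `u ↦ v` of the scheme with Brownian increment `z = δβ ∈ ℂ^P`: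
`v - e^{f(u)}u = i τ/(2h²) A (v + e^{f(u)}u) - (1/4) α τ (v + e^{f(u)}u) + ε σ Λ z`. -/
def IsStep {J P : ℕ} (α lam ε : ℝ) (τ : ℝ≥0) (η : ℕ+ → ℝ)
    (u : Fin J → ℂ) (z : Fin P → ℂ) (v : Fin J → ℂ) : Prop :=
  v - substep α lam τ u =
    (Complex.I * (τ / (2 * meshSize J ^ 2) : ℝ)) • (laplaceMatrix J *ᵥ (v + substep α lam τ u))
      - ((α * τ / 4 : ℝ) : ℂ) • (v + substep α lam τ u)
      + (ε : ℂ) • (sigmaMatrix J P *ᵥ (lambdaMatrix P η *ᵥ z))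

/-- `I - i τ/(2h²) A + (1/4) α τ I`. -/
def implicitMatrix (J : ℕ) (α : ℝ) (τ : ℝ≥0) : Matrix (Fin J) (Fin J) ℂ :=
  1 - (Complex.I * (τ / (2 * meshSize J ^ 2) : ℝ)) • laplaceMatrix J
    + ((α * τ / 4 : ℝ) : ℂ) • (1 : Matrix (Fin J) (Fin J) ℂ)

/-- `I + i τ/(2h²) A - (1/4) α τ I`. -/
def explicitMatrix (J : ℕ) (α : ℝ) (τ : ℝ≥0) : Matrix (Fin J) (Fin J) ℂ :=
  1 + (Complex.I * (τ / (2 * meshSize J ^ 2) : ℝ)) • laplaceMatrix J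
    - ((α * τ / 4 : ℝ) : ℂ) • (1 : Matrix (Fin J) (Fin J) ℂ)

/-- The explicit form of one step of the scheme. -/
def stepMap {J P : ℕ} (α lam ε : ℝ) (τ : ℝ≥0) (η : ℕ+ → ℝ)
    (u : Fin J → ℂ) (z : Fin P → ℂ) : Fin J → ℂ :=
  (implicitMatrix J α τ)⁻¹ *ᵥ (explicitMatrix J α τ *ᵥ substep α lam τ u)
    + (implicitMatrix J α τ)⁻¹ *ᵥ ((ε : ℂ) • (sigmaMatrix J P *ᵥ (lambdaMatrix P η *ᵥ z)))

open scoped ComplexOrder in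
theorem isUnit_det_implicitMatrix (J : ℕ) {α : ℝ} (hα : 0 < α) (τ : ℝ≥0) :
    IsUnit (implicitMatrix J α τ).det := by
  rw [isUnit_iff_ne_zero]
  intro h0
  obtain ⟨v, hv, hBv⟩ := Matrix.exists_mulVec_eq_zero_iff.mpr h0
  have hA : (laplaceMatrix J).IsHermitian := by
    ext i j
    simp only [Matrix.conjTranspose_apply, laplaceMatrix, Matrix.of_apply]
    by_cases hij : i = j
    · simp [hij]
    · rw [if_neg hij, if_neg (Ne.symm hij)]
      by_cases h : (i : ℕ) + 1 = j ∨ (j : ℕ) + 1 = i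
      · rw [if_pos h, if_pos h.symm]; simp
      · rw [if_neg h, if_neg (fun h' => h h'.symm)]; simp
  have him : (star v ⬝ᵥ laplaceMatrix J *ᵥ v).im = 0 := by
    simpa using hA.im_star_dotProduct_mulVec_self v
  have key : star v ⬝ᵥ (implicitMatrix J α τ *ᵥ v) = 0 := by rw [hBv]; simp
  rw [implicitMatrix, Matrix.add_mulVec, Matrix.sub_mulVec, Matrix.smul_mulVec,
    Matrix.smul_mulVec, Matrix.one_mulVec, dotProduct_add, dotProduct_sub, dotProduct_smul,
    dotProduct_smul] at key
  generalize (τ : ℝ) / (2 * meshSize J ^ 2) = c at key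
  have hre := congrArg Complex.re key
  have hpos : 0 < (star v ⬝ᵥ v).re := by
    have := Matrix.dotProduct_star_self_pos_iff (v := star v) |>.mpr (by simpa using hv)
    rw [star_star, dotProduct_comm] at this
    exact (Complex.pos_iff.mp this).1
  simp [him] at hre
  have : 0 ≤ α * (τ : ℝ) / 4 := by positivity
  nlinarith [mul_nonneg this hpos.le]

/-- The explicit form is the unique solution of the scheme. -/
theorem isStep_iff {J P : ℕ} {α : ℝ} (hα : 0 < α) (lam ε : ℝ) (τ : ℝ≥0) (η : ℕ+ → ℝ)
    (u : Fin J → ℂ) (z : Fin P → ℂ) (v : Fin J → ℂ) :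
    IsStep α lam ε τ η u z v ↔ v = stepMap α lam ε τ η u z := by
  have hB := isUnit_det_implicitMatrix J hα τ
  have h1 : IsStep α lam ε τ η u z v ↔ implicitMatrix J α τ *ᵥ v =
      explicitMatrix J α τ *ᵥ substep α lam τ u
        + (ε : ℂ) • (sigmaMatrix J P *ᵥ (lambdaMatrix P η *ᵥ z)) := by
    rw [IsStep, implicitMatrix, explicitMatrix, ← sub_eq_zero,
      ← sub_eq_zero (b := _ + (ε : ℂ) • _)]
    simp only [Matrix.add_mulVec, Matrix.sub_mulVec, Matrix.smul_mulVec, Matrix.one_mulVec,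
      Matrix.mulVec_add, smul_add]
    refine Eq.congr ?_ rfl
    abel
  rw [h1, stepMap, ← Matrix.mulVec_add]
  constructor
  · intro h
    rw [← h, Matrix.mulVec_mulVec, Matrix.nonsing_inv_mul _ hB, Matrix.one_mulVec]
  · intro h
    rw [h, Matrix.mulVec_mulVec, Matrix.mul_nonsing_inv _ hB, Matrix.one_mulVec]

theorem measurable_stepMap (J P : ℕ) (α lam ε : ℝ) (τ : ℝ≥0) (η : ℕ+ → ℝ) :
    Measurable fun p : (Fin J → ℂ) × (Fin P → ℂ) => stepMap α lam ε τ η p.1 p.2 := by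
  have h : ∀ u : Fin J → ℂ, substep α lam τ u =
      fun j => Complex.exp ((τ : ℝ) * (-((α : ℂ) / 2)
        + Complex.I * lam * ((‖u j‖ ^ 2 : ℝ) : ℂ))) * u j := by
    intro u
    have h2 : expArg α lam τ u = Matrix.diagonal fun j => (τ : ℝ) * (-((α : ℂ) / 2)
        + Complex.I * lam * ((‖u j‖ ^ 2 : ℝ) : ℂ)) := by
      rw [expArg, intensity, ← Matrix.diagonal_one, ← Matrix.diagonal_smul,
        ← Matrix.diagonal_smul, Matrix.diagonal_add, ← Matrix.diagonal_smul]
      congr 1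
      ext j
      simp
    ext j
    rw [substep, h2, Matrix.exp_diagonal, Matrix.mulVec_diagonal, Pi.coe_exp, Complex.exp_eq_exp_ℂ]
  have hs : Continuous fun u : Fin J → ℂ => substep α lam τ u := by
    simp_rw [h]
    fun_prop
  refine Continuous.measurable ?_
  unfold stepMap
  fun_prop

/-- The law of `N¹ + i N²` with independent centred real Gaussians of variance `τ`. -/
def complexGaussian (τ : ℝ≥0) : Measure ℂ :=
  ((gaussianReal 0 τ).prod (gaussianReal 0 τ)).map fun p => (p.1 : ℂ) + (p.2 : ℂ) * Complex.I

instance (τ : ℝ≥0) : IsProbabilityMeasure (complexGaussian τ) :=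
  Measure.isProbabilityMeasure_map (by fun_prop)

/-- The law of a Brownian increment `δβ ∈ ℂ^P` over a time step of length `τ`. -/
def incrementLaw (P : ℕ) (τ : ℝ≥0) : Measure (Fin P → ℂ) :=
  Measure.pi fun _ => complexGaussian τ

instance (P : ℕ) (τ : ℝ≥0) : IsProbabilityMeasure (incrementLaw P τ) := by
  unfold incrementLaw
  infer_instance

/-- The one-step transition kernel of the scheme on `ℂ^J`: the law, for a Brownian increment
`z = δβ`, of the solution of one step of the scheme started at `u`. -/
def transitionKernel (J P : ℕ) (α lam ε : ℝ) (τ : ℝ≥0) (η : ℕ+ → ℝ) :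
    Kernel (Fin J → ℂ) (Fin J → ℂ) where
  toFun u := (incrementLaw P τ).map (stepMap α lam ε τ η u)
  measurable' := by
    have hm := measurable_stepMap J P α lam ε τ η
    have h : (fun u : Fin J → ℂ => (incrementLaw P τ).map (stepMap α lam ε τ η u)) =
        fun u => ((incrementLaw P τ).map (Prod.mk u)).map
          fun p : (Fin J → ℂ) × (Fin P → ℂ) => stepMap α lam ε τ η p.1 p.2 := by
      funext u
      rw [Measure.map_map hm measurable_prodMk_left]
      rfl
    rw [h]
    exact (Measure.measurable_map _ hm).comp Measurable.map_prodMk_left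

/-- `Ψ⁰, Ψ¹, …` is a solution of the fully discrete scheme with initial function `ψ₀`:
`Ψ⁰ = (ψ₀(x_1), …, ψ₀(x_J))`, the random vector `Ψⁿ` is `ℱ_{t_n}`-measurable with `t_n = n τ`, and
almost surely each step satisfies the scheme with the increment `β(t_{n+1}) - β(t_n)`. -/
structure IsSchemeSolution {Ω : Type*} {mΩ : MeasurableSpace Ω} (ℱ : Filtration ℝ≥0 mΩ)
    (Pr : Measure Ω) (β : ℕ+ → ℝ≥0 → Ω → ℂ) (J P : ℕ) (α lam ε : ℝ) (τ : ℝ≥0) (η : ℕ+ → ℝ)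
    (ψ₀ : Ω → ℝ → ℂ) (Ψ : ℕ → Ω → (Fin J → ℂ)) : Prop where
  adapted : ∀ n : ℕ, Measurable[ℱ (n * τ)] (Ψ n)
  initial : ∀ᵐ ω ∂Pr, ∀ j, Ψ 0 ω j = ψ₀ ω (gridPoint J j)
  step : ∀ n : ℕ, ∀ᵐ ω ∂Pr, IsStep α lam ε τ η (Ψ n ω)
    (fun k : Fin P => β (k : ℕ).succPNat ((n + 1 : ℕ) * τ) ω - β (k : ℕ).succPNat (n * τ) ω)
    (Ψ (n + 1) ω)

/-- `Ψ` is a homogeneous Markov chain relative to the filtration `ℱ` sampled at the times `n τ`,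
with transition kernel `κ`: `Pr(Ψ^{n+1} ∈ S | ℱ_{nτ}) = κ(Ψⁿ, S)` almost surely. -/
def IsMarkovChain {Ω E : Type*} {mΩ : MeasurableSpace Ω} [MeasurableSpace E]
    (ℱ : Filtration ℝ≥0 mΩ) (Pr : Measure Ω) (τ : ℝ≥0) (κ : Kernel E E) (Ψ : ℕ → Ω → E) : Prop :=
  ∀ (n : ℕ) (S : Set E), MeasurableSet S →
    Pr[(Ψ (n + 1) ⁻¹' S).indicator (fun _ => (1 : ℝ)) | ℱ (n * τ)]
      =ᵐ[Pr] fun ω => (κ (Ψ n ω)).real S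

end

end DampedNLS

/-! One step has the form `drift u + noise z`: a deterministic map plus a linear image of a Gaussian
vector that does not depend on the current state. Three properties of this splitting carry the
theorem.

The drift shrinks the Euclidean norm by `exp (-(α τ / 2))`: the cubic term only turns phases, the
damping supplies the factor, and the implicit midpoint step does not increase the norm. Since the
noise has a constant finite mean norm, the laws of the chain are tight. The kernel is also Feller,
so Krylov–Bogoliubov makes every weak cluster point of the time averages invariant.

For `ε ≠ 0` the noise map is onto `ℂ^J`, because the discrete sine vectors are eigenvectors of `A`
with distinct eigenvalues and hence a basis. Two starting points then differ by a translation of the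
Gaussian increment, so all transition laws are mutually absolutely continuous, which excludes two
invariant probability measures (`invariant_unique_of_absolutelyContinuous`). For `ε = 0` the
iterated drift tends to `0`, and only the Dirac mass is invariant.

Uniqueness leaves the averages a single cluster point, so by compactness they converge. The Markov
property comes from independence of each increment from the past. -/

namespace DampedNLS

noncomputable section

/-! ### Invariant measures of Markov kernels -/

/-- A Markov kernel whose transition laws are mutually absolutely continuous has at most one
invariant probability measure. -/
theorem invariant_unique_of_absolutelyContinuous {E : Type*} [MeasurableSpace E]
    (κ : Kernel E E) [IsMarkovKernel κ] (hκ : ∀ u v, κ u ≪ κ v)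
    (μ ν : Measure E) [IsProbabilityMeasure μ] [IsProbabilityMeasure ν]
    (hμ : κ.Invariant μ) (hν : κ.Invariant ν) : μ = ν := by
  obtain ⟨s, hs, h1, h2⟩ := hahn_decomposition (μ := μ) (ν := ν)
  have le1 : ν.restrict s ≤ μ.restrict s := by
    refine Measure.le_iff.2 fun t ht => ?_
    rw [Measure.restrict_apply ht, Measure.restrict_apply ht]
    exact h1 _ (ht.inter hs) Set.inter_subset_right
  have le2 : μ.restrict sᶜ ≤ ν.restrict sᶜ := by
    refine Measure.le_iff.2 fun t ht => ?_
    rw [Measure.restrict_apply ht, Measure.restrict_apply ht]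
    exact h2 _ (ht.inter hs.compl) Set.inter_subset_right
  -- Here `c` is the minimum of `μ` and `ν`; `a` and `b` are the excesses of `μ` on `s` and of `ν`
  -- on `sᶜ`, and they have equal mass.
  set a := μ.restrict s - ν.restrict s with ha
  set b := ν.restrict sᶜ - μ.restrict sᶜ with hb
  set c := ν.restrict s + μ.restrict sᶜ with hc
  have hμc : μ = c + a := by
    rw [hc, add_right_comm, add_comm (ν.restrict s), ha, Measure.sub_add_cancel_of_le le1,
      Measure.restrict_add_restrict_compl hs]
  have hνc : ν = c + b := by
    rw [hc, add_assoc, add_comm (μ.restrict sᶜ), hb, Measure.sub_add_cancel_of_le le2,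
      Measure.restrict_add_restrict_compl hs]
  have hab : a Set.univ = b Set.univ := by
    have h3 : c Set.univ + a Set.univ = c Set.univ + b Set.univ := by
      rw [← Measure.add_apply, ← Measure.add_apply, ← hμc, ← hνc, measure_univ, measure_univ]
    exact (ENNReal.add_right_inj (measure_ne_top c _)).1 h3
  have haS : a sᶜ = 0 := by
    refine le_antisymm ((Measure.sub_le (μ := μ.restrict s) (ν := ν.restrict s) sᶜ).trans ?_)
      zero_le
    simp [Measure.restrict_apply hs.compl]
  have hbs : b s = 0 := by
    refine le_antisymm ((Measure.sub_le (μ := ν.restrict sᶜ) (ν := μ.restrict sᶜ) s).trans ?_)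
      zero_le
    simp [Measure.restrict_apply hs]
  have hint : ∀ m : Measure E, κ.Invariant m → m s = ∫⁻ u, κ u s ∂m := fun m hm => by
    conv_lhs => rw [← hm.def, Measure.bind_apply hs κ.measurable.aemeasurable]
  have hmu : μ s = c s + a s := by conv_lhs => rw [hμc, Measure.add_apply]
  have hnu : ν s = c s := by conv_lhs => rw [hνc, Measure.add_apply, hbs, add_zero]
  have e1 : c s + a s = ∫⁻ u, κ u s ∂c + ∫⁻ u, κ u s ∂a := by
    rw [← hmu, hint μ hμ, hμc, lintegral_add_measure]
  have e2 : c s = ∫⁻ u, κ u s ∂c + ∫⁻ u, κ u s ∂b := by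
    rw [← hnu, hint ν hν]; conv_lhs => rw [hνc, lintegral_add_measure]
  have hIa : ∫⁻ u, κ u s ∂a ≤ a s := by
    calc ∫⁻ u, κ u s ∂a ≤ ∫⁻ _, 1 ∂a := lintegral_mono fun u => prob_le_one
      _ = a Set.univ := by simp
      _ = a s + a sᶜ := (measure_add_measure_compl hs).symm
      _ = a s := by rw [haS, add_zero]
  have hIc : ∫⁻ u, κ u s ∂c ≠ ∞ := by
    refine ne_top_of_le_ne_top (measure_ne_top c Set.univ) ?_
    calc ∫⁻ u, κ u s ∂c ≤ ∫⁻ _, 1 ∂c := lintegral_mono fun u => prob_le_one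
      _ = c Set.univ := by simp
  -- Comparing `e1` and `e2` gives `a s + ∫ κ(·, s) db = ∫ κ(·, s) da ≤ a s`.
  have hIb : ∫⁻ u, κ u s ∂b = 0 := by
    have h3 : c s + a s + ∫⁻ u, κ u s ∂b ≤ c s + a s + 0 := by
      calc c s + a s + ∫⁻ u, κ u s ∂b
          = (∫⁻ u, κ u s ∂c + ∫⁻ u, κ u s ∂b) + ∫⁻ u, κ u s ∂a := by rw [e1]; ring
        _ ≤ c s + a s + 0 := by rw [← e2, add_zero]; gcongr
    exact le_antisymm ((ENNReal.add_le_add_iff_left (by finiteness)).1 h3) zero_le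
  -- If `b ≠ 0`, some `κ u` gives `s` mass zero, hence all do. Then `e1` and `e2` reduce to `a s =
  -- 0`, so `a`, and with it `b`, has no mass.
  have hb0 : b = 0 := by
    by_contra hne
    have h4 : ∀ᵐ u ∂b, κ u s = 0 :=
      (lintegral_eq_zero_iff (κ.measurable_coe hs)).1 hIb
    have : NeZero b := ⟨hne⟩
    obtain ⟨u, hu⟩ := h4.exists
    have h5 : ∀ v, κ v s = 0 := fun v => hκ v u hu
    have h6 : a s = 0 := by
      have : c s + a s = c s := by rw [e1, e2]; simp [h5]
      simpa [measure_ne_top] using this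
    have h7 : a Set.univ = 0 := by
      rw [← measure_add_measure_compl hs, h6, haS, add_zero]
    exact hne (Measure.measure_univ_eq_zero.1 (hab ▸ h7))
  have ha0 : a = 0 := Measure.measure_univ_eq_zero.1 (by rw [hab, hb0]; simp)
  rw [hμc, hνc, ha0, hb0]

/-! ### Time averages and the Krylov–Bogoliubov argument -/

section Cesaro

variable {E : Type*} [MeasurableSpace E]

/-- The average `(N + 1)⁻¹ ∑_{n ≤ N} ν_n`. -/
def cesaroMeasure (ν : ℕ → Measure E) (N : ℕ) : Measure E :=
  ((N + 1 : ℕ) : ℝ≥0∞)⁻¹ • ∑ n ∈ Finset.range (N + 1), ν n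

theorem cesaroMeasure_apply_le (ν : ℕ → Measure E) (N : ℕ) {s : Set E} {c : ℝ≥0∞}
    (h : ∀ n, ν n s ≤ c) : cesaroMeasure ν N s ≤ c := by
  rw [cesaroMeasure, Measure.smul_apply, Measure.finsetSum_apply, smul_eq_mul]
  calc ((N + 1 : ℕ) : ℝ≥0∞)⁻¹ * ∑ n ∈ Finset.range (N + 1), ν n s
      ≤ ((N + 1 : ℕ) : ℝ≥0∞)⁻¹ * (((N + 1 : ℕ) : ℝ≥0∞) * c) := by
        gcongr
        simpa using Finset.sum_le_card_nsmul (Finset.range (N + 1)) _ c fun n _ => h n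
    _ = c := by
        rw [← mul_assoc, ENNReal.inv_mul_cancel (by simp) (by simp), one_mul]

instance (ν : ℕ → Measure E) [∀ n, IsProbabilityMeasure (ν n)] (N : ℕ) :
    IsProbabilityMeasure (cesaroMeasure ν N) := by
  refine ⟨?_⟩
  rw [cesaroMeasure, Measure.smul_apply, Measure.finsetSum_apply, smul_eq_mul]
  simp only [measure_univ, Finset.sum_const, Finset.card_range, nsmul_eq_mul, mul_one]
  exact ENNReal.inv_mul_cancel (by simp) (by simp)

theorem integral_cesaroMeasure (ν : ℕ → Measure E) (N : ℕ) {g : E → ℝ}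
    (hg : ∀ n, Integrable g (ν n)) :
    ∫ x, g x ∂cesaroMeasure ν N =
      (1 / ((N + 1 : ℕ) : ℝ)) * ∑ n ∈ Finset.range (N + 1), ∫ x, g x ∂ν n := by
  rw [cesaroMeasure, integral_smul_measure, integral_finsetSum_measure fun n _ => hg n,
    ENNReal.toReal_inv, ENNReal.toReal_natCast, one_div, smul_eq_mul]

variable [TopologicalSpace E] [BorelSpace E]

/-- For a Feller kernel and a tight sequence of laws propagated by it, uniqueness of the invariant
probability measure implies its existence and the convergence of the time averages. -/
theorem exists_invariant_tendsto_cesaro [T2Space E] [HasOuterApproxClosed E]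
    (κ : Kernel E E) [IsMarkovKernel κ]
    (hF : ∀ g : BoundedContinuousFunction E ℝ, Continuous fun u => ∫ v, g v ∂κ u)
    (ν : ℕ → Measure E) [∀ n, IsProbabilityMeasure (ν n)] (hν : ∀ n, ν (n + 1) = (ν n).bind κ)
    (htight : ∀ c : ℝ≥0∞, 0 < c → ∃ K : Set E, IsCompact K ∧ ∀ n, ν n Kᶜ ≤ c)
    (huniq : ∀ μ μ' : Measure E, IsProbabilityMeasure μ → IsProbabilityMeasure μ' →
      κ.Invariant μ → κ.Invariant μ' → μ = μ') :
    ∃ μ : Measure E, IsProbabilityMeasure μ ∧ κ.Invariant μ ∧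
      ∀ g : BoundedContinuousFunction E ℝ,
        Tendsto (fun N : ℕ => (1 / (N : ℝ)) * ∑ n ∈ Finset.range N, ∫ x, g x ∂ν n)
          atTop (𝓝 (∫ x, g x ∂μ)) := by
  let avg : ℕ → ProbabilityMeasure E := fun N => ⟨cesaroMeasure ν N, inferInstance⟩
  -- Prokhorov: the averages inherit the uniform tail bound of the laws.
  have hK : IsCompact (closure (Set.range avg)) := by
    refine isCompact_closure_of_isTightMeasureSet ?_
    rw [isTightMeasureSet_iff_exists_isCompact_measure_compl_le]
    intro c hc
    obtain ⟨K, hK, hKc⟩ := htight c hc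
    refine ⟨K, hK, ?_⟩
    rintro _ ⟨_, ⟨N, rfl⟩, rfl⟩
    exact cesaroMeasure_apply_le ν N hKc
  have hmem : ∀ N, avg N ∈ closure (Set.range avg) := fun N => subset_closure ⟨N, rfl⟩
  have hinv : ∀ ρ : ProbabilityMeasure E, MapClusterPt ρ atTop avg →
      κ.Invariant (ρ : Measure E) := by
    intro ρ hρ
    have : IsProbabilityMeasure ((ρ : Measure E).bind κ) := by infer_instance
    refine ext_of_forall_integral_eq_of_IsFiniteMeasure fun g => ?_
    have hbound : ∀ u, ‖∫ v, g v ∂κ u‖ ≤ ‖g‖ := fun u => by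
      simpa using norm_integral_le_of_norm_le_const (μ := κ u) (ae_of_all _ g.norm_coe_le_norm)
    let Pg : BoundedContinuousFunction E ℝ :=
      BoundedContinuousFunction.ofNormedAddCommGroup (fun u => ∫ v, g v ∂κ u) (hF g) ‖g‖ hbound
    have hbind : ∀ m : Measure E, IsProbabilityMeasure m →
        ∫ x, g x ∂(m.bind κ) = ∫ x, Pg x ∂m := fun m _ =>
      Kernel.integral_comp (κ := Kernel.const Unit m) (a := ()) (η := κ) (g.integrable _)
    rw [hbind _ inferInstance]
    -- `G` is the defect of invariance tested on `g`. The Feller property makes it weakly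
    -- continuous, and along the averages it telescopes to a boundary term of size `O(1/N)`.
    let G : ProbabilityMeasure E → ℝ := fun m =>
      ∫ x, Pg x ∂(m : Measure E) - ∫ x, g x ∂(m : Measure E)
    have hG : Continuous G :=
      (ProbabilityMeasure.continuous_integral_boundedContinuousFunction Pg).sub
        (ProbabilityMeasure.continuous_integral_boundedContinuousFunction g)
    have hlim : Tendsto (G ∘ avg) atTop (𝓝 0) := by
      have hval : ∀ N, (G ∘ avg) N =
          (1 / ((N + 1 : ℕ) : ℝ)) * (∫ x, g x ∂ν (N + 1) - ∫ x, g x ∂ν 0) := by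
        intro N
        change ∫ x, Pg x ∂cesaroMeasure ν N - ∫ x, g x ∂cesaroMeasure ν N = _
        rw [integral_cesaroMeasure ν N fun n => Pg.integrable (ν n),
          integral_cesaroMeasure ν N fun n => g.integrable (ν n), ← mul_sub,
          ← Finset.sum_sub_distrib, ← Finset.sum_range_sub fun n => ∫ x, g x ∂ν n]
        congr 1
        refine Finset.sum_congr rfl fun n _ => ?_
        rw [hν n, hbind _ inferInstance]
      refine squeeze_zero_norm (a := fun N : ℕ => (1 / ((N : ℝ) + 1)) * (2 * ‖g‖)) ?_ ?_
      · intro N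
        rw [hval, norm_mul, Nat.cast_add_one]
        have h1 : ∀ n, ‖∫ x, g x ∂ν n‖ ≤ ‖g‖ := fun n => by
          simpa using norm_integral_le_of_norm_le_const (μ := ν n)
            (ae_of_all _ g.norm_coe_le_norm)
        have h2 : ‖(1 / ((N : ℝ) + 1))‖ = 1 / ((N : ℝ) + 1) :=
          Real.norm_of_nonneg (by positivity)
        rw [h2]
        gcongr
        calc _ ≤ _ := norm_sub_le _ _
          _ ≤ ‖g‖ + ‖g‖ := add_le_add (h1 _) (h1 _)
          _ = 2 * ‖g‖ := by ring
      · simpa using tendsto_one_div_add_atTop_nhds_zero_nat.mul_const (2 * ‖g‖)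
    have hcl : MapClusterPt (G ρ) atTop (G ∘ avg) := hρ.continuousAt_comp hG.continuousAt
    have hzero : G ρ = 0 := by
      have hne : (𝓝 (G ρ) ⊓ 𝓝 0).NeBot := hcl.neBot.mono (inf_le_inf_left _ hlim)
      exact eq_of_nhds_neBot hne
    exact sub_eq_zero.1 hzero
  obtain ⟨ρ, -, hρ⟩ := hK.exists_mapClusterPt (f := atTop) (u := avg)
    (tendsto_principal.2 (Eventually.of_forall hmem))
  -- In a compact set, a sequence with only one cluster point converges to it.
  have htend : Tendsto avg atTop (𝓝 ρ) := by
    refine hK.tendsto_nhds_of_unique_mapClusterPt (Eventually.of_forall hmem) fun ρ' _ hρ' => ?_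
    exact Subtype.ext (huniq _ _ ρ'.2 ρ.2 (hinv ρ' hρ') (hinv ρ hρ))
  refine ⟨ρ, ρ.2, hinv ρ hρ, fun g => ?_⟩
  -- `avg N` averages `N + 1` laws, so the index is shifted by one.
  rw [← tendsto_add_atTop_iff_nat 1]
  have h := (ProbabilityMeasure.tendsto_iff_forall_integral_tendsto.1 htend) g
  refine h.congr fun N => ?_
  exact integral_cesaroMeasure ν N fun n => g.integrable (ν n)

end Cesaro

/-- A sequence of random vectors with `‖X_{n+1}‖ ≤ ρ ‖X_n‖ + ξ_n`, where `ρ < 1` and `E ξ_n` is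
bounded, is bounded in probability. -/
theorem exists_measure_norm_gt_le_of_contraction {Ω F : Type*} {mΩ : MeasurableSpace Ω}
    [NormedAddCommGroup F] [MeasurableSpace F] [OpensMeasurableSpace F]
    (Pr : Measure Ω) [IsProbabilityMeasure Pr]
    (X : ℕ → Ω → F) (hX : Measurable (X 0)) (ξ : ℕ → Ω → ℝ) (ρ M : ℝ) (hρ0 : 0 ≤ ρ) (hρ : ρ < 1)
    (hξ0 : ∀ n ω, 0 ≤ ξ n ω) (hξ : ∀ n, Integrable (ξ n) Pr) (hM : ∀ n, ∫ ω, ξ n ω ∂Pr ≤ M)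
    (hstep : ∀ n, ∀ᵐ ω ∂Pr, ‖X (n + 1) ω‖ ≤ ρ * ‖X n ω‖ + ξ n ω)
    (c : ℝ≥0∞) (hc : 0 < c) : ∃ R : ℝ, ∀ n, Pr {ω | R < ‖X n ω‖} ≤ c := by
  -- `Y` solves the recursion with equality from the value `0`. Then `‖X n‖ ≤ ‖X 0‖ + Y n`, where `Y
  -- n` is controlled by its mean and `‖X 0‖` by being finite.
  let Y : ℕ → Ω → ℝ := fun n => n.rec (fun _ => 0) fun k Yk ω => ρ * Yk ω + ξ k ω
  have hY0 : ∀ n ω, 0 ≤ Y n ω := by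
    intro n ω
    induction n with
    | zero => exact le_rfl
    | succ k ih => exact add_nonneg (mul_nonneg hρ0 ih) (hξ0 k ω)
  have hYi : ∀ n, Integrable (Y n) Pr := by
    intro n
    induction n with
    | zero => exact integrable_zero _ _ _
    | succ k ih => exact (ih.const_mul ρ).add (hξ k)
  have h1ρ : 0 < 1 - ρ := by linarith
  have hM0 : 0 ≤ M := (integral_nonneg (hξ0 0)).trans (hM 0)
  have hYM : ∀ n, ∫ ω, Y n ω ∂Pr ≤ M / (1 - ρ) := by
    intro n
    induction n with
    | zero =>
      have : ∫ ω, Y 0 ω ∂Pr = 0 := by simp [Y]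
      rw [this]; positivity
    | succ k ih =>
      have : ∫ ω, Y (k + 1) ω ∂Pr = ρ * ∫ ω, Y k ω ∂Pr + ∫ ω, ξ k ω ∂Pr := by
        rw [← integral_const_mul]
        exact integral_add ((hYi k).const_mul ρ) (hξ k)
      rw [this]
      -- The bound `M / (1 - ρ)` is the fixed point of `m ↦ ρ m + M`.
      have h3 : ρ * (M / (1 - ρ)) + M = M / (1 - ρ) := by field_simp; ring
      linarith [mul_le_mul_of_nonneg_left ih hρ0, hM k]
  have hle : ∀ n, ∀ᵐ ω ∂Pr, ‖X n ω‖ ≤ ‖X 0 ω‖ + Y n ω := by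
    intro n
    induction n with
    | zero => exact ae_of_all _ fun ω => by simp [Y]
    | succ k ih =>
      filter_upwards [ih, hstep k] with ω h1 h2
      have h4 : Y (k + 1) ω = ρ * Y k ω + ξ k ω := rfl
      rw [h4]
      nlinarith [mul_le_mul_of_nonneg_left h1 hρ0, norm_nonneg (X 0 ω)]
  obtain ⟨R₁, hR₁⟩ : ∃ R₁ : ℝ, Pr {ω | R₁ < ‖X 0 ω‖} ≤ c / 2 := by
    have h := tendsto_measure_iInter_atTop (μ := Pr) (s := fun R : ℝ => {ω | R < ‖X 0 ω‖})
      (fun R => (measurableSet_lt measurable_const hX.norm).nullMeasurableSet)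
      (fun R R' h ω hω => lt_of_le_of_lt h hω) ⟨0, measure_ne_top _ _⟩
    have he : ⋂ R : ℝ, {ω | R < ‖X 0 ω‖} = ∅ := by
      refine Set.eq_empty_of_forall_notMem fun ω hω => ?_
      exact lt_irrefl ‖X 0 ω‖ (Set.mem_iInter.1 hω ‖X 0 ω‖)
    rw [he, measure_empty] at h
    exact ((h.eventually_lt_const (ENNReal.half_pos hc.ne')).mono fun _ h => h.le).exists
  obtain ⟨R₂, hR₂0, hR₂⟩ : ∃ R₂ : ℝ, 0 < R₂ ∧ ENNReal.ofReal (M / (1 - ρ) / R₂) ≤ c / 2 := by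
    have h : Tendsto (fun R : ℝ => ENNReal.ofReal (M / (1 - ρ) / R)) atTop (𝓝 0) := by
      have := ENNReal.tendsto_ofReal ((tendsto_const_nhds (x := M / (1 - ρ))).div_atTop tendsto_id)
      simpa using this
    obtain ⟨R, h1, h2⟩ := ((eventually_gt_atTop (0 : ℝ)).and
      (h.eventually_lt_const (ENNReal.half_pos hc.ne'))).exists
    exact ⟨R, h1, h2.le⟩
  refine ⟨R₁ + R₂, fun n => ?_⟩
  have hYR : Pr {ω | R₂ ≤ Y n ω} ≤ c / 2 := by
    refine le_trans ?_ hR₂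
    have h := mul_meas_ge_le_integral_of_nonneg (ae_of_all _ (hY0 n)) (hYi n) R₂
    rw [← ofReal_measureReal]
    refine ENNReal.ofReal_le_ofReal ?_
    rw [le_div_iff₀ hR₂0, mul_comm]
    exact h.trans (hYM n)
  calc Pr {ω | R₁ + R₂ < ‖X n ω‖}
      ≤ Pr ({ω | R₁ < ‖X 0 ω‖} ∪ {ω | R₂ ≤ Y n ω}) := by
        refine measure_mono_ae ?_
        filter_upwards [hle n] with ω h1 h2
        by_contra h3
        have h4 : ¬ (R₁ < ‖X 0 ω‖) ∧ ¬ (R₂ ≤ Y n ω) := not_or.1 h3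
        have h5 : R₁ + R₂ < ‖X n ω‖ := h2
        linarith [not_lt.1 h4.1, not_le.1 h4.2]
    _ ≤ c / 2 + c / 2 := (measure_union_le _ _).trans (add_le_add hR₁ hYR)
    _ = c := ENNReal.add_halves c

/-! ### The law of the increments -/

theorem pi_absolutelyContinuous {E : Type*} [MeasurableSpace E] {n : ℕ}
    (μ ν : Fin n → Measure E) [∀ i, SigmaFinite (μ i)] [∀ i, SigmaFinite (ν i)]
    (h : ∀ i, μ i ≪ ν i) : Measure.pi μ ≪ Measure.pi ν := by
  induction n with
  | zero => rw [Measure.pi_of_empty, Measure.pi_of_empty]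
  | succ n ih =>
    rw [← ((measurePreserving_piFinSuccAbove μ 0).symm).map_eq,
      ← ((measurePreserving_piFinSuccAbove ν 0).symm).map_eq]
    exact ((h 0).prod (ih _ _ fun i => h _)).map (MeasurableEquiv.measurable _)

/-- A nondegenerate complex Gaussian law is quasi-invariant under translations. -/
theorem complexGaussian_map_add_absolutelyContinuous {τ : ℝ≥0} (hτ : τ ≠ 0) (w : ℂ) :
    (complexGaussian τ).map (fun z => z + w) ≪ complexGaussian τ := by
  have hre : ∀ c : ℝ, (gaussianReal 0 τ).map (fun x => x + c) ≪ gaussianReal 0 τ := fun c => by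
    rw [gaussianReal_map_add_const]
    -- For nonzero variance, both Gaussians are equivalent to Lebesgue measure.
    exact (gaussianReal_absolutelyContinuous _ hτ).trans (gaussianReal_absolutelyContinuous' _ hτ)
  have h : (complexGaussian τ).map (fun z => z + w) =
      (((gaussianReal 0 τ).map fun x => x + w.re).prod
        ((gaussianReal 0 τ).map fun x => x + w.im)).map
          fun p => (p.1 : ℂ) + (p.2 : ℂ) * Complex.I := by
    rw [complexGaussian, Measure.map_map (by fun_prop) (by fun_prop),
      Measure.map_prod_map _ _ (by fun_prop) (by fun_prop),
      Measure.map_map (by fun_prop) (by fun_prop)]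
    congr 1
    ext p
    apply Complex.ext <;> simp
  have : IsProbabilityMeasure ((gaussianReal 0 τ).map fun x => x + w.re) :=
    Measure.isProbabilityMeasure_map (by fun_prop)
  have : IsProbabilityMeasure ((gaussianReal 0 τ).map fun x => x + w.im) :=
    Measure.isProbabilityMeasure_map (by fun_prop)
  rw [h, complexGaussian]
  exact ((hre _).prod (hre _)).map (by fun_prop)

theorem incrementLaw_map_add_absolutelyContinuous {τ : ℝ≥0} (hτ : τ ≠ 0) {P : ℕ}
    (w : Fin P → ℂ) : (incrementLaw P τ).map (fun z => z + w) ≪ incrementLaw P τ := by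
  have : ∀ i, IsProbabilityMeasure ((complexGaussian τ).map fun z => z + w i) := fun i =>
    Measure.isProbabilityMeasure_map (by fun_prop)
  have h := Measure.pi_map_pi (μ := fun _ : Fin P => complexGaussian τ)
    (f := fun i z => z + w i) fun i => by fun_prop
  change (Measure.pi _).map (fun (z : Fin P → ℂ) i => z i + w i) ≪ _
  rw [h]
  exact pi_absolutelyContinuous _ _ fun i => complexGaussian_map_add_absolutelyContinuous hτ (w i)

theorem integrable_norm_complexGaussian (τ : ℝ≥0) :
    Integrable (fun z : ℂ => ‖z‖) (complexGaussian τ) := by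
  rw [complexGaussian, integrable_map_measure (by fun_prop) (by fun_prop)]
  have hg : Integrable (fun x : ℝ => x) (gaussianReal 0 τ) :=
    memLp_one_iff_integrable.1 (memLp_id_gaussianReal 1)
  have h1 : Integrable (fun p : ℝ × ℝ => (p.1 : ℂ) + (p.2 : ℂ) * Complex.I)
      ((gaussianReal 0 τ).prod (gaussianReal 0 τ)) :=
    (hg.comp_fst _).ofReal.add ((hg.comp_snd _).ofReal.mul_const _)
  exact h1.norm

theorem integrable_norm_incrementLaw (P : ℕ) (τ : ℝ≥0) :
    Integrable (fun z : Fin P → ℂ => ‖z‖) (incrementLaw P τ) := by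
  have hk : ∀ k : Fin P, Integrable (fun z : Fin P → ℂ => ‖z k‖) (incrementLaw P τ) := fun k =>
    (measurePreserving_eval (fun _ : Fin P => complexGaussian τ) k).integrable_comp_of_integrable
      (integrable_norm_complexGaussian τ)
  refine (integrable_finsetSum Finset.univ fun k _ => hk k).mono' (by fun_prop)
    (ae_of_all _ fun z => ?_)
  rw [norm_norm]
  refine (pi_norm_le_iff_of_nonneg (by positivity)).2 fun k => ?_
  exact Finset.single_le_sum (f := fun k => ‖z k‖) (fun i _ => norm_nonneg _) (Finset.mem_univ k)

/-! ### Law and independence of the Brownian increments -/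

section Increment

variable {Ω : Type*} {mΩ : MeasurableSpace Ω} {Pr : Measure Ω}
  {ℱ : Filtration ℝ≥0 mΩ} {β : ℕ+ → ℝ≥0 → Ω → ℂ}

theorem IsComplexWiener.measurable (hβ : IsComplexWiener ℱ β Pr) (k : ℕ+) (t : ℝ≥0) :
    Measurable (β k t) :=
  (hβ.adapted k t).mono (ℱ.le t) le_rfl

/-- The `2P` real increments are independent Gaussians. Currying the index `Fin P × Fin 2` groups
them into `P` independent pairs, and each pair maps to a complex Gaussian. -/
theorem IsComplexWiener.map_increment [IsProbabilityMeasure Pr]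
    (hβ : IsComplexWiener ℱ β Pr) (P : ℕ) (s τ : ℝ≥0) :
    Pr.map (fun ω (k : Fin P) => β (k : ℕ).succPNat (s + τ) ω - β (k : ℕ).succPNat s ω)
      = incrementLaw P τ := by
  let W : Fin P × Fin 2 → Ω → ℝ := fun i ω =>
    if i.2 = 1 then (β (i.1 : ℕ).succPNat (s + τ) ω - β (i.1 : ℕ).succPNat s ω).im
    else (β (i.1 : ℕ).succPNat (s + τ) ω - β (i.1 : ℕ).succPNat s ω).re
  have hm : ∀ k t, Measurable (β k t) := hβ.measurable
  have hWm : ∀ i, Measurable (W i) := fun ⟨k, i⟩ => by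
    by_cases hi : i = 1 <;> simp only [W, hi, if_true, if_false] <;> fun_prop
  have hW : iIndepFun W Pr := by
    have hinj : Function.Injective
        fun i : Fin P × Fin 2 => ((i.1 : ℕ).succPNat, decide (i.2 = 1)) := by
      rintro ⟨k, i⟩ ⟨l, j⟩ h
      simp only [Prod.mk.injEq, Nat.succPNat_inj, Fin.val_inj, decide_eq_decide] at h
      refine Prod.ext h.1 ?_
      have := h.2
      revert this
      fin_cases i <;> fin_cases j <;> simp
    have h := (hβ.indep.precomp hinj).comp (fun _ (p : ℝ≥0 → ℝ) => p (s + τ) - p s)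
      fun _ => by fun_prop
    refine h.congr fun i => ae_of_all _ fun ω => ?_
    by_cases hi : i.2 = 1 <;> simp [W, hi]
  have hlaw : ∀ i, Pr.map (W i) = gaussianReal 0 τ := fun ⟨k, i⟩ => by
    have hd : nndist ((s + τ : ℝ≥0) : ℝ) (s : ℝ) = τ := by
      ext; simp
    by_cases hi : i = 1
    · have h := ((hβ.brownian_im (k : ℕ).succPNat).hasLaw_sub (s + τ) s).map_eq
      rw [show nndist ((s + τ : ℝ≥0)).1 s.1 = τ from hd] at h
      rw [← h]
      congr 1
      ext ω
      simp [W, hi]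
    · have h := ((hβ.brownian_re (k : ℕ).succPNat).hasLaw_sub (s + τ) s).map_eq
      rw [show nndist ((s + τ : ℝ≥0)).1 s.1 = τ from hd] at h
      rw [← h]
      congr 1
      ext ω
      simp [W, hi]
  have hjoint : Pr.map (fun ω i => W i ω) = Measure.pi fun _ => gaussianReal 0 τ := by
    rw [hW.map_fun_eq_pi_map fun i => (hWm i).aemeasurable]
    simp_rw [hlaw]
  -- Currying is used for infinite products, which agree with `Measure.pi` over finite index types.
  have hcurry := Measure.infinitePi_map_curry (ι := Fin P) (κ := Fin 2)
    fun _ _ => gaussianReal 0 τ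
  simp_rw [Measure.infinitePi_eq_pi] at hcurry
  let φ : (Fin 2 → ℝ) → ℂ := fun y => (y 0 : ℂ) + (y 1 : ℂ) * Complex.I
  have hφm : Measurable φ := by fun_prop
  have hφ : (Measure.pi fun _ : Fin 2 => gaussianReal 0 τ).map φ = complexGaussian τ := by
    rw [complexGaussian, ← (measurePreserving_piFinTwo fun _ => gaussianReal 0 τ).map_eq,
      Measure.map_map (by fun_prop) (by fun_prop)]
    rfl
  have hprob : IsProbabilityMeasure ((Measure.pi fun _ : Fin 2 => gaussianReal 0 τ).map φ) :=
    Measure.isProbabilityMeasure_map hφm.aemeasurable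
  have hpi := Measure.pi_map_pi (μ := fun _ : Fin P => Measure.pi fun _ : Fin 2 => gaussianReal 0 τ)
    (f := fun _ => φ) fun _ => hφm.aemeasurable
  rw [incrementLaw, ← hφ, ← hpi, ← hcurry, ← hjoint,
    Measure.map_map (by fun_prop) (by fun_prop), Measure.map_map (by fun_prop) (by fun_prop)]
  congr 1
  ext ω k
  apply Complex.ext <;> simp [φ, W, MeasurableEquiv.curry]

theorem IsComplexWiener.indep_increment (hβ : IsComplexWiener ℱ β Pr) (P : ℕ) (s τ : ℝ≥0) :
    Indep (MeasurableSpace.comap (fun ω (k : Fin P) =>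
      β (k : ℕ).succPNat (s + τ) ω - β (k : ℕ).succPNat s ω) inferInstance) (ℱ s) Pr := by
  refine indep_of_indep_of_le_left (hβ.indep_increments s (s + τ) le_self_add) ?_
  have h : Measurable fun (x : ℕ+ → ℂ) (k : Fin P) => x (k : ℕ).succPNat := by fun_prop
  refine le_trans (le_of_eq ?_) (MeasurableSpace.comap_mono h.comap_le)
  rw [MeasurableSpace.comap_comp]
  rfl

end Increment

/-- If `Y = g (X, Z)` almost surely, where `X` is `m`-measurable and `Z` is independent of `m`,
then `Pr (A ∩ {Y ∈ S}) = ∫_A Pr (g (x, Z) ∈ S)|_{x = X} dPr` for `A ∈ m`. -/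
theorem measure_inter_preimage_of_indep {Ω E F G : Type*} {m mΩ : MeasurableSpace Ω}
    [MeasurableSpace E] [MeasurableSpace F] [MeasurableSpace G]
    {Pr : Measure Ω} [IsProbabilityMeasure Pr] (hm : m ≤ mΩ)
    {X : Ω → E} (hX : Measurable[m] X) {Z : Ω → F} (hZ : Measurable Z)
    (hind : Indep (MeasurableSpace.comap Z inferInstance) m Pr)
    {g : E × F → G} (hg : Measurable g) {Y : Ω → G} (hY : ∀ᵐ ω ∂Pr, Y ω = g (X ω, Z ω))
    {A : Set Ω} (hA : MeasurableSet[m] A) {S : Set G} (hS : MeasurableSet S) :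
    Pr (A ∩ Y ⁻¹' S) = ∫⁻ ω in A, (Pr.map Z).map (fun z => g (X ω, z)) S ∂Pr := by
  -- Carrying the indicator of `A` along with `X` gives one `m`-measurable variable independent of
  -- `Z`, so the joint law is a product and Tonelli applies.
  let X' : Ω → ℝ≥0∞ × E := fun ω => (A.indicator 1 ω, X ω)
  have hX' : Measurable[m] X' :=
    Measurable.prodMk ((@measurable_const ℝ≥0∞ Ω _ m 1).indicator hA) hX
  have hX'm : Measurable X' := hX'.mono hm le_rfl
  have hindf : IndepFun X' Z Pr := by
    rw [IndepFun_iff_Indep]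
    exact indep_of_indep_of_le_left hind.symm hX'.comap_le
  have hmap := (indepFun_iff_map_prod_eq_prod_map_map hX'm.aemeasurable hZ.aemeasurable).1 hindf
  have hAm : MeasurableSet A := hm _ hA
  let f : (ℝ≥0∞ × E) × F → ℝ≥0∞ := fun p => p.1.1 * S.indicator 1 (g (p.1.2, p.2))
  have hf : Measurable f := by
    refine Measurable.mul (by fun_prop) ?_
    exact (measurable_one.indicator hS).comp (hg.comp (by fun_prop))
  have hB : MeasurableSet {ω | g (X ω, Z ω) ∈ S} :=
    (hg.comp ((hX.mono hm le_rfl).prodMk hZ)) hS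
  calc Pr (A ∩ Y ⁻¹' S) = Pr (A ∩ {ω | g (X ω, Z ω) ∈ S}) := by
        refine measure_congr ?_
        filter_upwards [hY] with ω h
        refine propext (and_congr Iff.rfl ?_)
        change Y ω ∈ S ↔ g (X ω, Z ω) ∈ S
        rw [h]
    _ = ∫⁻ ω, f (X' ω, Z ω) ∂Pr := by
        rw [← lintegral_indicator_one (hAm.inter hB)]
        refine lintegral_congr fun ω => ?_
        by_cases h1 : ω ∈ A <;> by_cases h2 : g (X ω, Z ω) ∈ S <;> simp [f, X', h1, h2]
    _ = ∫⁻ p, f p ∂(Pr.map fun ω => (X' ω, Z ω)) :=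
        (lintegral_map hf (hX'm.prodMk hZ)).symm
    _ = ∫⁻ x, ∫⁻ z, f (x, z) ∂(Pr.map Z) ∂(Pr.map X') := by
        rw [hmap]
        have : IsProbabilityMeasure (Pr.map Z) := Measure.isProbabilityMeasure_map hZ.aemeasurable
        exact lintegral_prod _ hf.aemeasurable
    _ = ∫⁻ ω, ∫⁻ z, f (X' ω, z) ∂(Pr.map Z) ∂Pr := by
        have : IsProbabilityMeasure (Pr.map Z) := Measure.isProbabilityMeasure_map hZ.aemeasurable
        exact lintegral_map hf.lintegral_prod_right' hX'm
    _ = ∫⁻ ω in A, (Pr.map Z).map (fun z => g (X ω, z)) S ∂Pr := by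
        rw [← lintegral_indicator hAm]
        refine lintegral_congr fun ω => ?_
        have hgω : Measurable fun z => g (X ω, z) := hg.comp measurable_prodMk_left
        by_cases h1 : ω ∈ A
        · simp only [f, X', h1, Set.indicator_of_mem, Pi.one_apply, one_mul]
          rw [← lintegral_indicator_one hS, lintegral_map (measurable_one.indicator hS) hgω]
        · simp [f, X', h1]

/-! ### The drift of one step is a contraction towards the origin -/

theorem substep_apply {J : ℕ} (α lam : ℝ) (τ : ℝ≥0) (u : Fin J → ℂ) (j : Fin J) :
    substep α lam τ u j =
      Complex.exp ((τ : ℝ) * (-((α : ℂ) / 2) + Complex.I * lam * ((‖u j‖ ^ 2 : ℝ) : ℂ))) * u j := by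
  have h : expArg α lam τ u = Matrix.diagonal fun j => (τ : ℝ) * (-((α : ℂ) / 2)
      + Complex.I * lam * ((‖u j‖ ^ 2 : ℝ) : ℂ)) := by
    rw [expArg, intensity, ← Matrix.diagonal_one, ← Matrix.diagonal_smul,
      ← Matrix.diagonal_smul, Matrix.diagonal_add, ← Matrix.diagonal_smul]
    congr 1
    ext j
    simp
  rw [substep, h, Matrix.exp_diagonal, Matrix.mulVec_diagonal, Pi.coe_exp, Complex.exp_eq_exp_ℂ]

/-- The cubic term enters the exponent with an imaginary coefficient, so only the damping affects
the modulus. -/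
theorem norm_substep_apply {J : ℕ} (α lam : ℝ) (τ : ℝ≥0) (u : Fin J → ℂ) (j : Fin J) :
    ‖substep α lam τ u j‖ = Real.exp (-(α * τ / 2)) * ‖u j‖ := by
  rw [substep_apply, norm_mul, Complex.norm_exp]
  have him : ((‖u j‖ : ℂ) ^ 2).im = 0 := by rw [← Complex.ofReal_pow, Complex.ofReal_im]
  congr 2
  simp [mul_assoc, him]
  ring

theorem norm_toLp_substep {J : ℕ} (α lam : ℝ) (τ : ℝ≥0) (u : Fin J → ℂ) :
    ‖WithLp.toLp 2 (substep α lam τ u)‖ = Real.exp (-(α * τ / 2)) * ‖WithLp.toLp 2 u‖ := by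
  rw [EuclideanSpace.norm_eq, EuclideanSpace.norm_eq]
  simp only [norm_substep_apply, mul_pow, ← Finset.mul_sum]
  rw [Real.sqrt_mul (by positivity), Real.sqrt_sq (by positivity)]

theorem laplaceMatrix_isHermitian (J : ℕ) : (laplaceMatrix J).IsHermitian := by
  ext i j
  simp only [Matrix.conjTranspose_apply, laplaceMatrix, Matrix.of_apply]
  by_cases hij : i = j
  · simp [hij]
  · rw [if_neg hij, if_neg (Ne.symm hij)]
    by_cases h : (i : ℕ) + 1 = j ∨ (j : ℕ) + 1 = i
    · rw [if_pos h, if_pos h.symm]; simp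
    · rw [if_neg h, if_neg (fun h' => h h'.symm)]; simp

/-- The implicit midpoint step for the damped linear Schrödinger equation does not increase the
Euclidean norm. -/
theorem norm_toLp_implicit_inv_explicit_le {J : ℕ} {α : ℝ} (hα : 0 < α) (τ : ℝ≥0)
    (w : Fin J → ℂ) :
    ‖WithLp.toLp 2 ((implicitMatrix J α τ)⁻¹ *ᵥ (explicitMatrix J α τ *ᵥ w))‖
      ≤ ‖WithLp.toLp 2 w‖ := by
  set v := (implicitMatrix J α τ)⁻¹ *ᵥ (explicitMatrix J α τ *ᵥ w) with hv
  have hB : implicitMatrix J α τ *ᵥ v = explicitMatrix J α τ *ᵥ w := by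
    rw [hv, Matrix.mulVec_mulVec,
      Matrix.mul_nonsing_inv _ (isUnit_det_implicitMatrix J hα τ), Matrix.one_mulVec]
  -- Midpoint form of the step. Pairing it with `v + w` gives `‖v‖² - ‖w‖²` as real part on the
  -- left; on the right the Hermitian term, multiplied by `I`, drops out and the damping is
  -- nonpositive.
  have hdiff : v - w = (Complex.I * (τ / (2 * meshSize J ^ 2) : ℝ)) •
      (laplaceMatrix J *ᵥ (v + w)) - ((α * τ / 4 : ℝ) : ℂ) • (v + w) := by
    rw [implicitMatrix, explicitMatrix] at hB
    simp only [Matrix.add_mulVec, Matrix.sub_mulVec, Matrix.smul_mulVec, Matrix.one_mulVec] at hB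
    rw [Matrix.mulVec_add, smul_add, smul_add]
    linear_combination (exp := 1) hB
  have him : (star (v + w) ⬝ᵥ laplaceMatrix J *ᵥ (v + w)).im = 0 := by
    simpa using (laplaceMatrix_isHermitian J).im_star_dotProduct_mulVec_self (v + w)
  have hself : ∀ x : Fin J → ℂ, (star x ⬝ᵥ x).re = ∑ i, ‖x i‖ ^ 2 := fun x => by
    simp [dotProduct, Complex.sq_norm, Complex.normSq_apply]
  have hpol : (star (v + w) ⬝ᵥ (v - w)).re = ∑ i, ‖v i‖ ^ 2 - ∑ i, ‖w i‖ ^ 2 := by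
    rw [← Finset.sum_sub_distrib, dotProduct, Complex.re_sum]
    refine Finset.sum_congr rfl fun i _ => ?_
    simp only [Complex.sq_norm, Complex.normSq_apply, Pi.star_apply, Pi.add_apply, Pi.sub_apply,
      Complex.mul_re, Complex.star_def, Complex.conj_re, Complex.conj_im, Complex.add_re,
      Complex.add_im, Complex.sub_re, Complex.sub_im]
    ring
  have hneg : (star (v + w) ⬝ᵥ (v - w)).re ≤ 0 := by
    rw [hdiff, dotProduct_sub, dotProduct_smul, dotProduct_smul]
    generalize (τ : ℝ) / (2 * meshSize J ^ 2) = c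
    have h1 := hself (v + w)
    have h2 : 0 ≤ ∑ i, ‖(v + w) i‖ ^ 2 := by positivity
    have h3 : 0 ≤ α * (τ : ℝ) / 4 := by positivity
    rw [smul_eq_mul, smul_eq_mul, Complex.sub_re, Complex.re_ofReal_mul, h1, mul_assoc,
      Complex.I_mul_re, Complex.im_ofReal_mul, him]
    nlinarith [mul_nonneg h3 h2]
  rw [EuclideanSpace.norm_eq, EuclideanSpace.norm_eq]
  refine Real.sqrt_le_sqrt ?_
  change ∑ i, ‖v i‖ ^ 2 ≤ ∑ i, ‖w i‖ ^ 2
  linarith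

/-- The deterministic part of one step of the scheme. -/
def drift {J : ℕ} (α lam : ℝ) (τ : ℝ≥0) (u : Fin J → ℂ) : Fin J → ℂ :=
  (implicitMatrix J α τ)⁻¹ *ᵥ (explicitMatrix J α τ *ᵥ substep α lam τ u)

/-- The stochastic part of one step of the scheme. -/
def noise (J : ℕ) {P : ℕ} (α ε : ℝ) (τ : ℝ≥0) (η : ℕ+ → ℝ) : (Fin P → ℂ) →ₗ[ℂ] (Fin J → ℂ) :=
  (ε : ℂ) • ((implicitMatrix J α τ)⁻¹ * sigmaMatrix J P * lambdaMatrix P η).mulVecLin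

theorem stepMap_eq_drift_add_noise {J P : ℕ} (α lam ε : ℝ) (τ : ℝ≥0) (η : ℕ+ → ℝ)
    (u : Fin J → ℂ) (z : Fin P → ℂ) :
    stepMap α lam ε τ η u z = drift α lam τ u + noise J α ε τ η z := by
  rw [stepMap, drift, noise, Matrix.mulVec_smul, LinearMap.smul_apply, Matrix.mulVecLin_apply,
    ← Matrix.mulVec_mulVec, ← Matrix.mulVec_mulVec]

/-- The Euclidean norm replaces the sup norm of `Fin J → ℂ` because the midpoint estimate is an
inner-product identity. -/
theorem norm_toLp_drift_le {J : ℕ} {α : ℝ} (hα : 0 < α) (lam : ℝ) (τ : ℝ≥0) (u : Fin J → ℂ) :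
    ‖WithLp.toLp 2 (drift α lam τ u)‖ ≤ Real.exp (-(α * τ / 2)) * ‖WithLp.toLp 2 u‖ :=
  (norm_toLp_implicit_inv_explicit_le hα τ _).trans (norm_toLp_substep α lam τ u).le

theorem continuous_drift {J : ℕ} (α lam : ℝ) (τ : ℝ≥0) :
    Continuous (drift (J := J) α lam τ) := by
  have hs : Continuous fun u : Fin J → ℂ => substep α lam τ u := by
    refine continuous_pi fun j => ?_
    simp_rw [substep_apply]
    fun_prop
  unfold drift
  fun_prop

theorem continuous_noise (J : ℕ) {P : ℕ} (α ε : ℝ) (τ : ℝ≥0) (η : ℕ+ → ℝ) :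
    Continuous (noise J (P := P) α ε τ η) :=
  LinearMap.continuous_of_finiteDimensional _

/-! ### Nondegeneracy of the noise -/

/-- The vanishing values at `0` and `J + 1` are the Dirichlet condition; they let the first and last
rows obey the same second-difference formula. -/
theorem laplaceMatrix_mulVec_apply {J : ℕ} (s : ℕ → ℂ) (h0 : s 0 = 0) (hJ : s (J + 1) = 0)
    (j : Fin J) :
    (laplaceMatrix J *ᵥ fun i => s (i + 1)) j = s j - 2 * s (j + 1) + s (j + 2) := by
  have hentry : ∀ i : ℕ, (if (j : ℕ) = i then (-2 : ℂ) else
      if (j : ℕ) + 1 = i ∨ i + 1 = j then 1 else 0) * s (i + 1) =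
      (if i = (j : ℕ) then -2 * s (i + 1) else 0) + (if i = (j : ℕ) + 1 then s (i + 1) else 0)
        + (if i + 1 = (j : ℕ) then s (i + 1) else 0) := by
    intro i
    by_cases h1 : i = (j : ℕ)
    · subst h1; simp
    · by_cases h2 : i = (j : ℕ) + 1
      · subst h2
        have : ¬ ((j : ℕ) + 1 + 1 = j) := by omega
        simp [this]
      · by_cases h3 : i + 1 = (j : ℕ)
        · have h4 : ¬ (i = i + 1 + 1) := by omega
          simp [← h3, h4]
        · have h4 : ¬ (j : ℕ) = i := fun h => h1 h.symm
          have h5 : ¬ (j : ℕ) + 1 = i := fun h => h2 h.symm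
          simp [h1, h2, h3, h4, h5]
  have hsum : (laplaceMatrix J *ᵥ fun i => s (i + 1)) j =
      ∑ i ∈ Finset.range J, (if (j : ℕ) = i then (-2 : ℂ) else
        if (j : ℕ) + 1 = i ∨ i + 1 = j then 1 else 0) * s (i + 1) := by
    rw [← Fin.sum_univ_eq_sum_range fun i => (if (j : ℕ) = i then (-2 : ℂ) else
      if (j : ℕ) + 1 = i ∨ i + 1 = j then 1 else 0) * s (i + 1)]
    simp [Matrix.mulVec, dotProduct, laplaceMatrix, Fin.ext_iff]
  have h1 : ∑ i ∈ Finset.range J, (if i = (j : ℕ) then -2 * s (i + 1) else 0) =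
      -2 * s (j + 1) := by
    rw [Finset.sum_ite_eq' (Finset.range J) (j : ℕ) fun i => -2 * s (i + 1),
      if_pos (Finset.mem_range.2 j.2)]
  have h2 : ∑ i ∈ Finset.range J, (if i = (j : ℕ) + 1 then s (i + 1) else 0) = s (j + 2) := by
    rw [Finset.sum_ite_eq' (Finset.range J) ((j : ℕ) + 1) fun i => s (i + 1)]
    split_ifs with h
    · rfl
    · have : (j : ℕ) + 2 = J + 1 := by have := j.2; rw [Finset.mem_range] at h; omega
      rw [this, hJ]
  have h3 : ∑ i ∈ Finset.range J, (if i + 1 = (j : ℕ) then s (i + 1) else 0) = s j := by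
    rcases Nat.eq_zero_or_pos (j : ℕ) with hj | hj
    · rw [hj, h0]; simp
    · obtain ⟨k, hk⟩ := Nat.exists_eq_succ_of_ne_zero hj.ne'
      have : k < J := by have := j.2; omega
      simp only [hk, Nat.succ_eq_add_one, add_left_inj]
      rw [Finset.sum_ite_eq' (Finset.range J) k fun i => s (i + 1),
        if_pos (Finset.mem_range.2 this)]
  rw [hsum, Finset.sum_congr rfl fun i _ => hentry i, Finset.sum_add_distrib,
    Finset.sum_add_distrib, h1, h2, h3]
  ring

/-- The discretised eigenfunctions are eigenvectors of the discrete Laplacian. -/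
theorem laplaceMatrix_mulVec_eigenfun (J : ℕ) (k : ℕ+) :
    (laplaceMatrix J *ᵥ fun j => (eigenfun k (gridPoint J j) : ℂ)) =
      ((2 * Real.cos (k * Real.pi * meshSize J) - 2 : ℝ) : ℂ) •
        fun j => (eigenfun k (gridPoint J j) : ℂ) := by
  set θ := k * Real.pi * meshSize J with hθ
  let s : ℕ → ℂ := fun i => ((√2 * Real.sin (i * θ) : ℝ) : ℂ)
  have he : (fun j : Fin J => (eigenfun k (gridPoint J j) : ℂ)) = fun j : Fin J => s ((j : ℕ) + 1) := by
    ext j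
    simp only [s, eigenfun, gridPoint, hθ, Nat.cast_add, Nat.cast_one]
    congr 3
    ring
  have hJ : s (J + 1) = 0 := by
    have : ((J + 1 : ℕ) : ℝ) * θ = (k : ℕ) * Real.pi := by
      rw [hθ, meshSize]; push_cast; field_simp
    simp only [s, this, Real.sin_nat_mul_pi, mul_zero, Complex.ofReal_zero]
  rw [he]
  ext j
  rw [laplaceMatrix_mulVec_apply s (by simp [s]) hJ, Pi.smul_apply, smul_eq_mul]
  simp only [s]
  norm_cast
  -- Both neighbours are expanded about the angle `(j + 1) θ`; the cosine terms cancel.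
  have h1 : ((j : ℕ) : ℝ) * θ = ((j + 1 : ℕ) : ℝ) * θ - θ := by push_cast; ring
  have h2 : ((j + 2 : ℕ) : ℝ) * θ = ((j + 1 : ℕ) : ℝ) * θ + θ := by push_cast; ring
  rw [h1, h2, Real.sin_sub, Real.sin_add]
  ring

/-- On this interval cosine is injective and sine is positive, which makes the eigenvalues distinct
and the eigenvectors nonzero. -/
theorem meshAngle_mem_Ioo {J : ℕ} (k : Fin J) :
    ((k : ℕ).succPNat : ℝ) * Real.pi * meshSize J ∈ Set.Ioo 0 Real.pi := by
  have h1 : ((k : ℕ).succPNat : ℝ) = (k : ℝ) + 1 := by simp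
  have h2 : (k : ℝ) + 1 ≤ J := by exact_mod_cast k.2
  have h3 : (0 : ℝ) ≤ k := by positivity
  rw [h1, meshSize]
  constructor
  · positivity
  · rw [mul_one_div, div_lt_iff₀ (by positivity), mul_comm]
    exact mul_lt_mul_of_pos_left (by linarith) Real.pi_pos

theorem linearIndependent_eigenfun_gridPoint (J : ℕ) :
    LinearIndependent ℂ fun (k : Fin J) (j : Fin J) =>
      (eigenfun (k : ℕ).succPNat (gridPoint J j) : ℂ) := by
  refine Module.End.eigenvectors_linearIndependent' (laplaceMatrix J).mulVecLin
    (fun k : Fin J =>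
      ((2 * Real.cos (((k : ℕ).succPNat : ℝ) * Real.pi * meshSize J) - 2 : ℝ) : ℂ)) ?_ _ ?_
  · intro k l h
    have h1 : Real.cos (((k : ℕ).succPNat : ℝ) * Real.pi * meshSize J) =
        Real.cos (((l : ℕ).succPNat : ℝ) * Real.pi * meshSize J) := by
      have := Complex.ofReal_injective h
      linarith
    have h2 := Real.injOn_cos (Set.Ioo_subset_Icc_self (meshAngle_mem_Ioo k))
      (Set.Ioo_subset_Icc_self (meshAngle_mem_Ioo l)) h1
    have hm : meshSize J ≠ 0 := by rw [meshSize]; positivity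
    have h3 := mul_right_cancel₀ Real.pi_ne_zero (mul_right_cancel₀ hm h2)
    have h4 : ((k : ℕ).succPNat : ℕ) = ((l : ℕ).succPNat : ℕ) := by exact_mod_cast h3
    exact Fin.ext (by simpa using h4)
  · intro k
    refine Module.End.hasEigenvector_iff.2 ⟨Module.End.mem_eigenspace_iff.2 ?_, fun h => ?_⟩
    · exact laplaceMatrix_mulVec_eigenfun J _
    -- At the first grid point the entry is `√2` times the sine of the mesh angle.
    · have h0 := congrFun h ⟨0, k.pos⟩
      have hs := Real.sin_pos_of_mem_Ioo (meshAngle_mem_Ioo k)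
      have h5 : eigenfun (k : ℕ).succPNat (gridPoint J ⟨0, k.pos⟩) = 0 := by
        simpa only [Pi.zero_apply, Complex.ofReal_eq_zero] using h0
      rw [eigenfun, gridPoint] at h5
      simp only [Nat.cast_zero, zero_add, one_mul] at h5
      exact (mul_pos (by positivity) hs).ne' h5

/-- The first `J` columns, available since `J ≤ P`, already form a basis. -/
theorem sigmaMatrix_mulVec_surjective {J P : ℕ} (hJP : J ≤ P) :
    Function.Surjective (sigmaMatrix J P *ᵥ ·) := by
  change Function.Surjective (sigmaMatrix J P).mulVecLin
  rw [← LinearMap.range_eq_top, Matrix.range_mulVecLin, eq_top_iff,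
    ← (linearIndependent_eigenfun_gridPoint J).span_eq_top_of_card_eq_finrank' (by simp)]
  refine Submodule.span_mono ?_
  rintro _ ⟨k, rfl⟩
  exact ⟨Fin.castLE hJP k, rfl⟩

theorem noise_surjective {J P : ℕ} (hJP : J ≤ P) {α : ℝ} (hα : 0 < α) {ε : ℝ} (hε : ε ≠ 0)
    (τ : ℝ≥0) {η : ℕ+ → ℝ} (hη : ∀ k : ℕ+, (k : ℕ) ≤ P → 0 < η k) :
    Function.Surjective (noise J (P := P) α ε τ η) := by
  intro y
  obtain ⟨x, hx⟩ := sigmaMatrix_mulVec_surjective hJP (implicitMatrix J α τ *ᵥ ((ε : ℂ)⁻¹ • y))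
  refine ⟨fun k => ((√(η (k : ℕ).succPNat) : ℝ) : ℂ)⁻¹ * x k, ?_⟩
  have hΛ : lambdaMatrix P η *ᵥ (fun k => ((√(η (k : ℕ).succPNat) : ℝ) : ℂ)⁻¹ * x k) = x := by
    ext k
    rw [lambdaMatrix, Matrix.mulVec_diagonal, mul_inv_cancel_left₀]
    have : 0 < √(η (k : ℕ).succPNat) := Real.sqrt_pos.2 (hη _ (by simp))
    exact_mod_cast this.ne'
  simp only at hx
  rw [noise, LinearMap.smul_apply, Matrix.mulVecLin_apply, ← Matrix.mulVec_mulVec, hΛ,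
    ← Matrix.mulVec_mulVec, hx, Matrix.mulVec_mulVec,
    Matrix.nonsing_inv_mul _ (isUnit_det_implicitMatrix J hα τ), Matrix.one_mulVec, smul_smul,
    mul_inv_cancel₀ (by exact_mod_cast hε), one_smul]

/-! ### The transition kernel -/

theorem transitionKernel_apply (J P : ℕ) (α lam ε : ℝ) (τ : ℝ≥0) (η : ℕ+ → ℝ) (u : Fin J → ℂ) :
    transitionKernel J P α lam ε τ η u = (incrementLaw P τ).map (stepMap α lam ε τ η u) := rfl

theorem measurable_stepMap_right {J P : ℕ} (α lam ε : ℝ) (τ : ℝ≥0) (η : ℕ+ → ℝ)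
    (u : Fin J → ℂ) : Measurable (stepMap (P := P) α lam ε τ η u) := by
  simp_rw [funext (stepMap_eq_drift_add_noise α lam ε τ η u)]
  exact (continuous_const.add (continuous_noise J α ε τ η)).measurable

instance (J P : ℕ) (α lam ε : ℝ) (τ : ℝ≥0) (η : ℕ+ → ℝ) :
    IsMarkovKernel (transitionKernel J P α lam ε τ η) :=
  ⟨fun u => Measure.isProbabilityMeasure_map (measurable_stepMap_right α lam ε τ η u).aemeasurable⟩

theorem transitionKernel_feller (J P : ℕ) (α lam ε : ℝ) (τ : ℝ≥0) (η : ℕ+ → ℝ)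
    (g : BoundedContinuousFunction (Fin J → ℂ) ℝ) :
    Continuous fun u => ∫ v, g v ∂transitionKernel J P α lam ε τ η u := by
  have h : ∀ u, ∫ v, g v ∂transitionKernel J P α lam ε τ η u =
      ∫ z, g (stepMap α lam ε τ η u z) ∂incrementLaw P τ := fun u => by
    rw [transitionKernel_apply]
    exact integral_map (measurable_stepMap_right α lam ε τ η u).aemeasurable
      g.continuous.aestronglyMeasurable
  simp_rw [h]
  refine continuous_of_dominated (bound := fun _ => ‖g‖) (fun u => ?_)
    (fun u => ae_of_all _ fun z => g.norm_coe_le_norm _) (integrable_const _)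
    (ae_of_all _ fun z => ?_)
  · exact (g.continuous.measurable.comp
      (measurable_stepMap_right α lam ε τ η u)).aestronglyMeasurable
  · simp_rw [stepMap_eq_drift_add_noise]
    exact g.continuous.comp ((continuous_drift α lam τ).add continuous_const)

/-- Surjectivity of the noise turns the difference of the two drifts into a shift `w` of the
increment, and the increment law is quasi-invariant under shifts. -/
theorem transitionKernel_absolutelyContinuous {J P : ℕ} (hJP : J ≤ P) {α : ℝ} (hα : 0 < α)
    (lam : ℝ) {ε : ℝ} (hε : ε ≠ 0) {τ : ℝ≥0} (hτ : τ ≠ 0) {η : ℕ+ → ℝ}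
    (hη : ∀ k : ℕ+, (k : ℕ) ≤ P → 0 < η k) (u v : Fin J → ℂ) :
    transitionKernel J P α lam ε τ η u ≪ transitionKernel J P α lam ε τ η v := by
  obtain ⟨w, hw⟩ := noise_surjective hJP hα hε τ hη (drift α lam τ u - drift α lam τ v)
  have h : stepMap α lam ε τ η u = stepMap α lam ε τ η v ∘ fun z => z + w := by
    ext1 z
    simp only [Function.comp_apply, stepMap_eq_drift_add_noise, map_add, hw]
    abel
  rw [transitionKernel_apply, transitionKernel_apply, h,
    ← Measure.map_map (measurable_stepMap_right α lam ε τ η v) (by fun_prop)]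
  exact (incrementLaw_map_add_absolutelyContinuous hτ w).map
    (measurable_stepMap_right α lam ε τ η v)

theorem exp_neg_damping_lt_one {α : ℝ} (hα : 0 < α) {τ : ℝ≥0} (hτ : 0 < τ) :
    Real.exp (-(α * τ / 2)) < 1 := by
  have : (0 : ℝ) < τ := by exact_mod_cast hτ
  rw [Real.exp_lt_one_iff]
  have : 0 < α * τ / 2 := by positivity
  linarith

theorem tendsto_iterate_drift {J : ℕ} {α : ℝ} (hα : 0 < α) (lam : ℝ) {τ : ℝ≥0} (hτ : 0 < τ)
    (u : Fin J → ℂ) : Tendsto (fun n => (drift α lam τ)^[n] u) atTop (𝓝 0) := by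
  have hle : ∀ n, ‖WithLp.toLp 2 ((drift α lam τ)^[n] u)‖ ≤
      Real.exp (-(α * τ / 2)) ^ n * ‖WithLp.toLp 2 u‖ := by
    intro n
    induction n with
    | zero => simp
    | succ n ih =>
      rw [Function.iterate_succ_apply', pow_succ', mul_assoc]
      exact (norm_toLp_drift_le hα lam τ _).trans (by gcongr)
  have h0 : Tendsto (fun n => WithLp.toLp 2 ((drift α lam τ)^[n] u)) atTop (𝓝 0) := by
    refine squeeze_zero_norm hle ?_
    simpa using (tendsto_pow_atTop_nhds_zero_of_lt_one (by positivity)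
      (exp_neg_damping_lt_one hα hτ)).mul_const ‖WithLp.toLp 2 u‖
  exact ((PiLp.continuous_ofLp 2 fun _ : Fin J => ℂ).tendsto 0).comp h0

/-- Without noise, the only invariant probability measure is the Dirac mass at the origin. -/
theorem invariant_eq_dirac {J P : ℕ} {α : ℝ} (hα : 0 < α) (lam : ℝ) {τ : ℝ≥0} (hτ : 0 < τ)
    (η : ℕ+ → ℝ) (μ : Measure (Fin J → ℂ)) [IsProbabilityMeasure μ]
    (hμ : (transitionKernel J P α lam 0 τ η).Invariant μ) : μ = Measure.dirac 0 := by
  have hd : Measurable (drift (J := J) α lam τ) := (continuous_drift α lam τ).measurable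
  have hκ : transitionKernel J P α lam 0 τ η = Kernel.deterministic (drift α lam τ) hd := by
    ext1 u
    have hs : stepMap (P := P) α lam 0 τ η u = fun _ => drift α lam τ u := by
      ext1 z
      simp [stepMap_eq_drift_add_noise, noise]
    rw [transitionKernel_apply, hs, Measure.map_const, Kernel.deterministic_apply]
    simp
  have hmap : MeasurePreserving (drift (J := J) α lam τ) μ μ := by
    refine ⟨hd, ?_⟩
    rw [← Measure.deterministic_comp_eq_map hd, ← hκ]
    exact hμ
  refine ext_of_forall_integral_eq_of_IsFiniteMeasure fun g => ?_
  -- These integrals do not depend on `n`, yet by dominated convergence they tend to `g 0`.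
  have hiter : ∀ n, ∫ u, g ((drift α lam τ)^[n] u) ∂μ = ∫ u, g u ∂μ := fun n => by
    have h := hmap.iterate n
    conv_rhs => rw [← h.map_eq]
    exact (integral_map h.aemeasurable g.continuous.aestronglyMeasurable).symm
  have hlim : Tendsto (fun n => ∫ u, g ((drift α lam τ)^[n] u) ∂μ) atTop (𝓝 (∫ _, g 0 ∂μ)) := by
    refine tendsto_integral_of_dominated_convergence (fun _ => ‖g‖) (fun n => ?_)
      (integrable_const _) (fun n => ae_of_all _ fun u => g.norm_coe_le_norm _)
      (ae_of_all _ fun u => ?_)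
    · exact (g.continuous.comp ((continuous_drift α lam τ).iterate n)).aestronglyMeasurable
    · exact (g.continuous.tendsto 0).comp (tendsto_iterate_drift hα lam hτ u)
  simp_rw [hiter] at hlim
  rw [tendsto_nhds_unique tendsto_const_nhds hlim]
  simp

theorem transitionKernel_invariant_unique {J P : ℕ} (hJP : J ≤ P) {α : ℝ} (hα : 0 < α)
    (lam ε : ℝ) {τ : ℝ≥0} (hτ : 0 < τ) {η : ℕ+ → ℝ}
    (hη : ∀ k : ℕ+, (k : ℕ) ≤ P → 0 < η k)
    (μ ν : Measure (Fin J → ℂ)) [IsProbabilityMeasure μ] [IsProbabilityMeasure ν]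
    (hμ : (transitionKernel J P α lam ε τ η).Invariant μ)
    (hν : (transitionKernel J P α lam ε τ η).Invariant ν) : μ = ν := by
  rcases eq_or_ne ε 0 with rfl | hε
  · rw [invariant_eq_dirac hα lam hτ η μ hμ, invariant_eq_dirac hα lam hτ η ν hν]
  · exact invariant_unique_of_absolutelyContinuous _
      (transitionKernel_absolutelyContinuous hJP hα lam hε hτ.ne' hη) μ ν hμ hν

/-! ### Solutions of the scheme -/

section Solution

variable {Ω : Type*} {mΩ : MeasurableSpace Ω} {Pr : Measure Ω} {ℱ : Filtration ℝ≥0 mΩ}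
  {β : ℕ+ → ℝ≥0 → Ω → ℂ} {J P : ℕ} {α lam ε : ℝ} {τ : ℝ≥0} {η : ℕ+ → ℝ} {ψ₀ : Ω → ℝ → ℂ}
  {Ψ : ℕ → Ω → (Fin J → ℂ)}

theorem IsSchemeSolution.measurable (hΨ : IsSchemeSolution ℱ Pr β J P α lam ε τ η ψ₀ Ψ) (n : ℕ) :
    Measurable (Ψ n) :=
  (hΨ.adapted n).mono (ℱ.le _) le_rfl

theorem IsSchemeSolution.eq_stepMap (hα : 0 < α)
    (hΨ : IsSchemeSolution ℱ Pr β J P α lam ε τ η ψ₀ Ψ) (n : ℕ) :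
    ∀ᵐ ω ∂Pr, Ψ (n + 1) ω = stepMap α lam ε τ η (Ψ n ω) fun k : Fin P =>
      β (k : ℕ).succPNat (n * τ + τ) ω - β (k : ℕ).succPNat (n * τ) ω := by
  have ht : ((n + 1 : ℕ) : ℝ≥0) * τ = n * τ + τ := by push_cast; ring
  filter_upwards [hΨ.step n] with ω h
  rw [ht] at h
  exact (isStep_iff hα lam ε τ η _ _ _).1 h

theorem IsComplexWiener.measurable_increment (hβ : IsComplexWiener ℱ β Pr) (P : ℕ) (s τ : ℝ≥0) :
    Measurable fun ω (k : Fin P) =>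
      β (k : ℕ).succPNat (s + τ) ω - β (k : ℕ).succPNat s ω :=
  measurable_pi_lambda _ fun _ => (hβ.measurable _ _).sub (hβ.measurable _ _)

variable [IsProbabilityMeasure Pr]

/-- Integrated Markov property: general `A` identifies the conditional expectation, and `A = univ`
gives the evolution of the laws. -/
theorem IsSchemeSolution.measure_inter_preimage (hα : 0 < α) (hβ : IsComplexWiener ℱ β Pr)
    (hΨ : IsSchemeSolution ℱ Pr β J P α lam ε τ η ψ₀ Ψ) (n : ℕ)
    {A : Set Ω} (hA : MeasurableSet[ℱ (n * τ)] A) {S : Set (Fin J → ℂ)} (hS : MeasurableSet S) :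
    Pr (A ∩ Ψ (n + 1) ⁻¹' S) = ∫⁻ ω in A, transitionKernel J P α lam ε τ η (Ψ n ω) S ∂Pr := by
  have h := measure_inter_preimage_of_indep (ℱ.le (n * τ)) (hΨ.adapted n)
    (hβ.measurable_increment P (n * τ) τ) (hβ.indep_increment P (n * τ) τ)
    (measurable_stepMap J P α lam ε τ η) (hΨ.eq_stepMap hα n) hA hS
  rwa [hβ.map_increment] at h

theorem IsSchemeSolution.isMarkovChain (hα : 0 < α) (hβ : IsComplexWiener ℱ β Pr)
    (hΨ : IsSchemeSolution ℱ Pr β J P α lam ε τ η ψ₀ Ψ) :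
    IsMarkovChain ℱ Pr τ (transitionKernel J P α lam ε τ η) Ψ := by
  intro n S hS
  have hpre : MeasurableSet (Ψ (n + 1) ⁻¹' S) := hΨ.measurable (n + 1) hS
  have hκS : Measurable fun u => (transitionKernel J P α lam ε τ η u).real S :=
    ((transitionKernel J P α lam ε τ η).measurable_coe hS).ennreal_toReal
  have hint : Integrable (fun ω => (transitionKernel J P α lam ε τ η (Ψ n ω)).real S) Pr :=
    (integrable_const (1 : ℝ)).mono' (hκS.comp (hΨ.measurable n)).aestronglyMeasurable
      (ae_of_all _ fun ω => by
        rw [Real.norm_of_nonneg measureReal_nonneg]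
        exact measureReal_le_one)
  refine (ae_eq_condExp_of_forall_setIntegral_eq (ℱ.le _)
    ((integrable_const (1 : ℝ)).indicator hpre) (fun _ _ _ => hint.integrableOn)
    (fun A hA _ => ?_) (hκS.comp (hΨ.adapted n)).stronglyMeasurable.aestronglyMeasurable).symm
  have hAm : MeasurableSet A := ℱ.le _ _ hA
  rw [setIntegral_indicator hpre, setIntegral_const, smul_eq_mul, mul_one, Measure.real,
    hΨ.measure_inter_preimage hα hβ n hA hS]
  refine integral_toReal ?_ (ae_of_all _ fun ω => measure_lt_top _ _)
  exact (((transitionKernel J P α lam ε τ η).measurable_coe hS).comp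
    (hΨ.measurable n)).aemeasurable

theorem IsSchemeSolution.map_succ (hα : 0 < α) (hβ : IsComplexWiener ℱ β Pr)
    (hΨ : IsSchemeSolution ℱ Pr β J P α lam ε τ η ψ₀ Ψ) (n : ℕ) :
    Pr.map (Ψ (n + 1)) = (Pr.map (Ψ n)).bind (transitionKernel J P α lam ε τ η) := by
  ext S hS
  have h := hΨ.measure_inter_preimage hα hβ n MeasurableSet.univ hS
  rw [Set.univ_inter, Measure.restrict_univ] at h
  rw [Measure.map_apply (hΨ.measurable _) hS, h,
    Measure.bind_apply hS (Kernel.aemeasurable _),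
    lintegral_map (Kernel.measurable_coe _ hS) (hΨ.measurable n)]

/-- The contraction lemma applies with `ξ n` the norm of the noise, whose law, and so whose finite
mean, is the same at every step. -/
theorem IsSchemeSolution.tight (hα : 0 < α) (hτ : 0 < τ) (hβ : IsComplexWiener ℱ β Pr)
    (hΨ : IsSchemeSolution ℱ Pr β J P α lam ε τ η ψ₀ Ψ) (c : ℝ≥0∞) (hc : 0 < c) :
    ∃ K : Set (Fin J → ℂ), IsCompact K ∧ ∀ n, Pr.map (Ψ n) Kᶜ ≤ c := by
  let Z : ℕ → Ω → Fin P → ℂ := fun n ω k =>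
    β (k : ℕ).succPNat (n * τ + τ) ω - β (k : ℕ).succPNat (n * τ) ω
  have hZ : ∀ n, Measurable (Z n) := fun n => hβ.measurable_increment P (n * τ) τ
  have hZlaw : ∀ n, Pr.map (Z n) = incrementLaw P τ := fun n => hβ.map_increment P (n * τ) τ
  let N : (Fin P → ℂ) → ℝ := fun z => ‖WithLp.toLp 2 (noise J α ε τ η z)‖
  have hNc : Continuous N :=
    ((PiLp.continuous_toLp 2 fun _ : Fin J => ℂ).comp (continuous_noise J α ε τ η)).norm
  have hNi : Integrable N (incrementLaw P τ) := by
    let L : (Fin P → ℂ) →L[ℂ] EuclideanSpace ℂ (Fin J) :=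
      LinearMap.toContinuousLinearMap
        ((WithLp.linearEquiv 2 ℂ (Fin J → ℂ)).symm.toLinearMap ∘ₗ noise J α ε τ η)
    refine ((integrable_norm_incrementLaw P τ).const_mul ‖L‖).mono' hNc.aestronglyMeasurable
      (ae_of_all _ fun z => ?_)
    rw [Real.norm_of_nonneg (norm_nonneg _)]
    exact L.le_opNorm z
  have hNZ : ∀ n, Integrable (fun ω => N (Z n ω)) Pr := fun n => by
    have h : Integrable N (Pr.map (Z n)) := by rwa [hZlaw]
    exact h.comp_measurable (hZ n)
  have hto : Measurable (WithLp.toLp 2 : (Fin J → ℂ) → EuclideanSpace ℂ (Fin J)) :=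
    (PiLp.continuous_toLp 2 fun _ : Fin J => ℂ).measurable
  obtain ⟨R, hR⟩ := exists_measure_norm_gt_le_of_contraction Pr
    (fun n ω => (WithLp.toLp 2 (Ψ n ω) : EuclideanSpace ℂ (Fin J)))
    (hto.comp (hΨ.measurable 0)) (fun n ω => N (Z n ω)) (Real.exp (-(α * τ / 2)))
    (∫ z, N z ∂incrementLaw P τ) (Real.exp_pos _).le (exp_neg_damping_lt_one hα hτ)
    (fun n ω => norm_nonneg _) hNZ
    (fun n => by
      rw [← hZlaw n, integral_map (hZ n).aemeasurable hNc.aestronglyMeasurable])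
    (fun n => by
      filter_upwards [hΨ.eq_stepMap hα n] with ω h
      rw [h, stepMap_eq_drift_add_noise, WithLp.toLp_add]
      exact (norm_add_le _ _).trans (add_le_add_left (norm_toLp_drift_le hα lam τ _) _))
    c hc
  -- The compact set is a Euclidean ball carried over to the space with the sup norm.
  refine ⟨WithLp.ofLp '' Metric.closedBall (0 : EuclideanSpace ℂ (Fin J)) R,
    (isCompact_closedBall _ _).image (PiLp.continuous_ofLp 2 _), fun n => ?_⟩
  have hK : IsCompact (WithLp.ofLp '' Metric.closedBall (0 : EuclideanSpace ℂ (Fin J)) R) :=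
    (isCompact_closedBall _ _).image (PiLp.continuous_ofLp 2 _)
  rw [Measure.map_apply (hΨ.measurable n) hK.measurableSet.compl]
  refine (measure_mono fun ω hω => ?_).trans (hR n)
  by_contra hle
  refine hω ⟨WithLp.toLp 2 (Ψ n ω), ?_, rfl⟩
  rw [mem_closedBall_zero_iff]
  exact not_lt.1 hle

end Solution

end

end DampedNLS

/-! ### Unique ergodicity of the scheme -/

theorem mainTheorem3
    {Ω : Type*} {mΩ : MeasurableSpace Ω} (Pr : Measure Ω) [IsProbabilityMeasure Pr]
    (ℱ : Filtration ℝ≥0 mΩ)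
    (β : ℕ+ → ℝ≥0 → Ω → ℂ) (hβ : DampedNLS.IsComplexWiener ℱ β Pr)
    (α lam ε : ℝ) (hα : 0 < α) (hlam : lam = 1 ∨ lam = -1) (hε : 0 ≤ ε)
    (η : ℕ+ → ℝ) (hη : ∀ k, 0 ≤ η k)
    (Q : DampedNLS.L2 →L[ℂ] DampedNLS.L2) (hQ_pos : Q.IsPositive)
    (hQ_eig : ∀ k, Q (DampedNLS.eigenvec k) = ((√(η k) : ℝ) : ℂ) • DampedNLS.eigenvec k)
    (hQ_HS : DampedNLS.IsHilbertSchmidtHdot 2 Q)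
    (J P : ℕ) (hJ : 1 ≤ J) (hJP : J ≤ P)
    (C : ℝ) (hC : 1 ≤ C) (hPC : (P : ℝ) ≤ C * (J + 1))
    (hη_pos : ∀ k : ℕ+, (k : ℕ) ≤ P → 0 < η k)
    (τ : ℝ≥0) (hτ : 0 < τ)
    (ψ₀ : Ω → ℝ → ℂ) (hψ₀_meas : Measurable (Function.uncurry ψ₀))
    (hψ₀_adapted : ∀ x, Measurable[ℱ 0] fun ω => ψ₀ ω x)
    (hψ₀_moment : (∫⁻ ω, (∫⁻ x in Set.Ioo (0 : ℝ) 1, ‖ψ₀ ω x‖ₑ ^ 2) ∂Pr) < ∞)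
    (Ψ : ℕ → Ω → (Fin J → ℂ))
    (hΨ : DampedNLS.IsSchemeSolution ℱ Pr β J P α lam ε τ η ψ₀ Ψ) :
    DampedNLS.IsMarkovChain ℱ Pr τ (DampedNLS.transitionKernel J P α lam ε τ η) Ψ ∧
    ∃ μ : Measure (Fin J → ℂ), IsProbabilityMeasure μ ∧
      (DampedNLS.transitionKernel J P α lam ε τ η).Invariant μ ∧
      (∀ ν : Measure (Fin J → ℂ), IsProbabilityMeasure ν →
        (DampedNLS.transitionKernel J P α lam ε τ η).Invariant ν → ν = μ) ∧
      ∀ f : BoundedContinuousFunction (Fin J → ℂ) ℝ,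
        Tendsto (fun N : ℕ => (1 / (N : ℝ)) * ∑ n ∈ Finset.range N, ∫ ω, f (Ψ n ω) ∂Pr)
          atTop (𝓝 (∫ u, f u ∂μ)) := by
  refine ⟨hΨ.isMarkovChain hα hβ, ?_⟩
  have hprob : ∀ n, IsProbabilityMeasure (Pr.map (Ψ n)) := fun n =>
    Measure.isProbabilityMeasure_map (hΨ.measurable n).aemeasurable
  obtain ⟨μ, hμ, hinv, hlim⟩ := DampedNLS.exists_invariant_tendsto_cesaro
    (DampedNLS.transitionKernel J P α lam ε τ η)
    (DampedNLS.transitionKernel_feller J P α lam ε τ η) (fun n => Pr.map (Ψ n))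
    (hΨ.map_succ hα hβ) (hΨ.tight hα hτ hβ)
    (fun _ _ _ _ h h' =>
      DampedNLS.transitionKernel_invariant_unique hJP hα lam ε hτ hη_pos _ _ h h')
  refine ⟨μ, hμ, hinv, fun ν _ hν => DampedNLS.transitionKernel_invariant_unique hJP hα lam ε hτ
    hη_pos ν μ hν hinv, fun f => (hlim f).congr fun N => ?_⟩
  congr 1
  exact Finset.sum_congr rfl fun n _ =>
    integral_map (hΨ.measurable n).aemeasurable f.continuous.aestronglyMeasurable
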